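/- Graphs are finite, simple and undirected. Let $G$ be a unicyclic graph, that is, a connected graph with exactly one cycle $\mathcal C$; let $\ell\ge 3$ be the length of $\mathcal C$. A set $S\subseteq V(G)$ is a metric generator if for any two distinct vertices $x,y$ there is $s\in S$ with $d_G(s,x)\ne d_G(s,y)$, and $\dim(G)$ is the least cardinality of a metric generator. For $c\in V(\mathcal C)$ let $T_c$ be the component of $G-E(\mathcal C)$ containing $c$. For $S\subseteq V(G)$, a vertex $c\in V(\mathcal C)$ is $S$-active if $T_c$ contains a vertex of $S$, and $\mathcal A(S)$ is the set of $S$-active vertices. A vertex $v$ is branching if $v\in V(\mathcal C)$ and $d_G(v)\ge 4$, or $v\notin V(\mathcal C)$ and $d_G(v)\ge 3$. A thread attached to a vertex $v$ of degree at least $3$ is a path $v_1\dots v_k$ ($k\ge 1$) with $v_1v\in E(G)$, in which $v_1,\dots,v_{k-1}$ have degree $2$ and $v_k$ has degree $1$ in $G$; $\mathcal S(v)$ is the set of threads attached to $v$. A vertex of $\mathcal C$ is bad if it has degree at least $4$ and there is a thread attached to it. A set $S\subseteq V(G)$ is branch-resolving if for every vertex $v$ of degree at least $3$ at least $|\mathcal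 S(v)|-1$ threads in $\mathcal S(v)$ contain a vertex of $S$. Let $L(G)$ be the least cardinality of a branch-resolving set, and $\mathcal B(G)$ the set of all branch-resolving sets of cardinality $L(G)$ that consist of vertices of degree $1$ only. Three distinct vertices $x,y,z$ of $\mathcal C$ form a geodesic triple if $d_G(x,y)+d_G(y,z)+d_G(z,x)=\ell$. A labelling of $\mathcal C$ is a sequence $a_0,\dots,a_{\ell-1}$ of distinct vertices with $\mathcal C=a_0a_1\dots a_{\ell-1}a_0$. If $\mathcal A(S)\ne\emptyset$, a labelling is normal (with respect to $S$) if $a_0\in\mathcal A(S)$ and $\max\{i: a_i\in\mathcal A(S)\}$ is as small as possible among all labellings with $a_0\in\mathcal A(S)$. For a labelling and an integer $j$ consider the conditions: (i) neither $a_0$ nor $a_j$ is bad; (ii) if $j<\lfloor\frac{\ell-2}{2}\rfloor$, then, with $m=\lfloor\frac{\ell-2}{2}\rfloor-j$, $V(T_{a_k})=\{a_k\}$ for every $k\in\{\ell-1,\dots,\ell-m\}\cup\{j+1,\dots,j+m\}$; (iii) if $j>1$ and $T_{a_k}$ contains no branching vertex for every $k\in[1,j-1]$ (so that all these $T_{a_k}$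 are paths), then each $T_{a_k}$ with $k\in[1,j-1]$ has length at most $\frac{\ell-2}{2}-j$. With respect to the labelling, $G\in\mathcal O(\ell,j)$ means that $\ell$ is odd, $1\le j\le\frac{\ell-1}{2}$, and either $j=\frac{\ell-1}{2}$ or (i) and (ii) hold; $G\in\mathcal E(\ell,j)$ means that $\ell$ is even, $1\le j\le\lfloor\frac{\ell-1}{2}\rfloor$, and (i), (ii) and (iii) hold. Let $S\in\mathcal B(G)$. When $|\mathcal A(S)|\ge 2$, fix any normal labelling of $\mathcal C$ and let $j=\max\{i:a_i\in\mathcal A(S)\}$. Suppose $\ell$ is odd. (1) If $\mathcal A(S)=\emptyset$, then $\dim(G)=2$. (2) If $|\mathcal A(S)|=1$, then $\dim(G)=L(G)+1$. (3) If $|\mathcal A(S)|\ge 2$, then $\dim(G)=L(G)$ if there are three $S$-active vertices forming a geodesic triple or $G\in\mathcal O(\ell,j)$, and $\dim(G)=L(G)+1$ otherwise. Suppose $\ell$ is even. (1) If $\mathcal A(S)=\emptyset$, then $\dim(G)=2$ if there are a labelling of $\mathcal C$ and an integer $k$ with $G\in\mathcal E(\ell,k)$, and $\dim(G)=3$ otherwise.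 (2) If $\mathcal A(S)=\{c\}$, then $\dim(G)=L(G)+1$ if there are a vertex $c'\in V(\mathcal C)\setminus\{c\}$, a labelling of $\mathcal C$ and an integer $k$ with $\{a_0,a_k\}=\{c,c'\}$ and $G\in\mathcal E(\ell,k)$, and $\dim(G)=L(G)+2$ otherwise. (3) If $|\mathcal A(S)|\ge 2$, then $\dim(G)=L(G)$ if there are three $S$-active vertices forming a geodesic triple or $G\in\mathcal E(\ell,j)$, and $\dim(G)=L(G)+1$ otherwise. -/

import Mathlib

namespace UnicyclicDim

/-- `S` is a metric generator of `G`: any two distinct vertices have different distances to some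
vertex of `S`. -/
def IsMetricGenerator {V : Type*} (G : SimpleGraph V) (S : Set V) : Prop :=
  ∀ x y : V, x ≠ y → ∃ s ∈ S, G.dist s x ≠ G.dist s y

/-- The metric dimension `dim(G)`: the least cardinality of a metric generator. -/
noncomputable def metricDim {V : Type*} (G : SimpleGraph V) : ℕ :=
  sInf {k : ℕ | ∃ S : Set V, IsMetricGenerator G S ∧ S.ncard = k}

/-- A unicyclic graph: a connected graph with exactly one cycle (cycles are identified with their
edge sets, so that the starting point and the direction of travel do not matter). -/
def IsUnicyclic {V : Type*} (G : SimpleGraph V) : Prop :=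
  G.Connected ∧
    ∃! E : Set (Sym2 V), ∃ (u : V) (c : G.Walk u u), c.IsCycle ∧ E = {e | e ∈ c.edges}

/-- The edges lying on a cycle of `G`; for unicyclic `G`, the edge set of its cycle. -/
def cycleEdges {V : Type*} (G : SimpleGraph V) : Set (Sym2 V) :=
  {e | ∃ (u : V) (c : G.Walk u u), c.IsCycle ∧ e ∈ c.edges}

/-- The vertices lying on a cycle of `G`; for unicyclic `G`, the vertex set of its cycle. -/
def cycleVerts {V : Type*} (G : SimpleGraph V) : Set V :=
  {v | ∃ (u : V) (c : G.Walk u u), c.IsCycle ∧ v ∈ c.support}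

/-- The length `ℓ` of the cycle of a unicyclic graph `G`. -/
noncomputable def cycleLength {V : Type*} (G : SimpleGraph V) : ℕ :=
  (cycleEdges G).ncard

/-- The degree of `v`. -/
noncomputable def deg {V : Type*} (G : SimpleGraph V) (v : V) : ℕ :=
  (G.neighborSet v).ncard

/-- The vertex set of `T_c`, the component containing `c` of the graph that is left when the edges
of the cycle are deleted. -/
def treeVerts {V : Type*} (G : SimpleGraph V) (c : V) : Set V :=
  {w | (G.deleteEdges (cycleEdges G)).Reachable c w}

/-- The number of edges of the tree `T_c`; this is its length when it is a path. -/
noncomputable def treeLength {V : Type*} (G : SimpleGraph V) (c : V) : ℕ :=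
  (treeVerts G c).ncard - 1

/-- `𝒜(S)`: the `S`-active vertices, i.e. the vertices `c` of the cycle such that `T_c` contains a
vertex of `S`. -/
def active {V : Type*} (G : SimpleGraph V) (S : Set V) : Set V :=
  {c | c ∈ cycleVerts G ∧ ∃ s ∈ S, s ∈ treeVerts G c}

/-- Branching vertices. -/
def IsBranching {V : Type*} (G : SimpleGraph V) (v : V) : Prop :=
  (v ∈ cycleVerts G ∧ 4 ≤ deg G v) ∨ (v ∉ cycleVerts G ∧ 3 ≤ deg G v)

/-- `l = v₁ … v_k` (`k ≥ 1`) is a thread attached to the vertex `v` of degree at least `3`: a path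
in which `v₁, …, v_{k-1}` have degree `2`, `v_k` has degree `1`, and `v₁` is adjacent to `v`. -/
structure IsThread {V : Type*} (G : SimpleGraph V) (v : V) (l : List V) : Prop where
  three_le_deg : 3 ≤ deg G v
  ne_nil : l ≠ []
  nodup : l.Nodup
  chain : l.IsChain G.Adj
  adj_head : ∀ x ∈ l.head?, G.Adj v x
  deg_inner : ∀ x ∈ l.dropLast, deg G x = 2
  deg_last : ∀ x ∈ l.getLast?, deg G x = 1

/-- The set of all threads attached to `v`. -/
def threads {V : Type*} (G : SimpleGraph V) (v : V) : Set (List V) :=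
  {l | IsThread G v l}

/-- Bad vertices: vertices of the cycle of degree at least `4` with a thread attached. -/
def IsBad {V : Type*} (G : SimpleGraph V) (v : V) : Prop :=
  v ∈ cycleVerts G ∧ 4 ≤ deg G v ∧ (threads G v).Nonempty

/-- Branch-resolving sets: for every vertex `v` of degree at least `3`, at most one of the threads
attached to `v` contains no vertex of `S`, i.e. at least `|threads G v| - 1` of them contain one. -/
def IsBranchResolving {V : Type*} (G : SimpleGraph V) (S : Set V) : Prop :=
  ∀ v : V, 3 ≤ deg G v →
    (threads G v).ncard - 1 ≤ {l | l ∈ threads G v ∧ ∃ x ∈ l, x ∈ S}.ncard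

/-- `L(G)`: the least cardinality of a branch-resolving set. -/
noncomputable def branchNumber {V : Type*} (G : SimpleGraph V) : ℕ :=
  sInf {k : ℕ | ∃ S : Set V, IsBranchResolving G S ∧ S.ncard = k}

/-- `ℬ(G)`: the minimum branch-resolving sets that consist of vertices of degree `1` only. -/
def minBranchSets {V : Type*} (G : SimpleGraph V) : Set (Set V) :=
  {S | IsBranchResolving G S ∧ S.ncard = branchNumber G ∧ ∀ s ∈ S, deg G s = 1}

/-- `a 0, a 1, …, a (ℓ - 1)` is a labelling of a cycle of length `ℓ` of `G`, i.e. the cycle is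
`a₀ a₁ … a_{ℓ-1} a₀`; indices are read modulo `ℓ`. -/
def IsCycleLabelling {V : Type*} (G : SimpleGraph V) {ℓ : ℕ} (a : ZMod ℓ → V) : Prop :=
  3 ≤ ℓ ∧ Function.Injective a ∧ ∀ i : ZMod ℓ, G.Adj (a i) (a (i + 1))

/-- The largest `i` in `{0, …, ℓ - 1}` such that `a i` is `S`-active. -/
noncomputable def maxActiveIndex {V : Type*} (G : SimpleGraph V) (S : Set V) {ℓ : ℕ}
    (a : ZMod ℓ → V) : ℕ :=
  sSup {i : ℕ | i < ℓ ∧ a (i : ZMod ℓ) ∈ active G S}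

/-- Normal labellings with respect to `S`: `a 0` is `S`-active, and the largest index of an
`S`-active vertex is as small as possible among such labellings. -/
def IsNormalLabelling {V : Type*} (G : SimpleGraph V) (S : Set V) {ℓ : ℕ}
    (a : ZMod ℓ → V) : Prop :=
  IsCycleLabelling G a ∧ a 0 ∈ active G S ∧
    ∀ b : ZMod ℓ → V, IsCycleLabelling G b → b 0 ∈ active G S →
      maxActiveIndex G S a ≤ maxActiveIndex G S b

/-- There are three (distinct) `S`-active vertices forming a geodesic triple. -/
def HasActiveGeodesicTriple {V : Type*} (G : SimpleGraph V) (S : Set V) : Prop :=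
  ∃ x ∈ active G S, ∃ y ∈ active G S, ∃ z ∈ active G S, x ≠ y ∧ y ≠ z ∧ z ≠ x ∧
    G.dist x y + G.dist y z + G.dist z x = cycleLength G

/-- Neither `a 0` nor `a j` is a bad vertex. -/
def CondBad {V : Type*} (G : SimpleGraph V) {ℓ : ℕ} (a : ZMod ℓ → V) (j : ℕ) : Prop :=
  ¬ IsBad G (a 0) ∧ ¬ IsBad G (a (j : ZMod ℓ))

/-- If `j < ⌊(ℓ-2)/2⌋`, then with `m = ⌊(ℓ-2)/2⌋ - j` the tree `T_{a_k}` is the single vertex `a_k`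
for each `k` in `{ℓ-1, …, ℓ-m} ∪ {j+1, …, j+m}`. -/
def CondTrivial {V : Type*} (G : SimpleGraph V) {ℓ : ℕ} (a : ZMod ℓ → V) (j : ℕ) : Prop :=
  j < (ℓ - 2) / 2 →
    ∀ k : ℕ, k ∈ Set.Icc (ℓ - ((ℓ - 2) / 2 - j)) (ℓ - 1) ∪ Set.Icc (j + 1) (j + ((ℓ - 2) / 2 - j)) →
      treeVerts G (a (k : ZMod ℓ)) = {a (k : ZMod ℓ)}

/-- If `j > 1` and none of `T_{a_1}, …, T_{a_{j-1}}` contains a branching vertex (so that they are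
paths), then each of them has length at most `(ℓ-2)/2 - j`. -/
def CondShort {V : Type*} (G : SimpleGraph V) {ℓ : ℕ} (a : ZMod ℓ → V) (j : ℕ) : Prop :=
  1 < j →
    (∀ k ∈ Set.Icc 1 (j - 1), ∀ w ∈ treeVerts G (a (k : ZMod ℓ)), ¬ IsBranching G w) →
      ∀ k ∈ Set.Icc 1 (j - 1), treeLength G (a (k : ZMod ℓ)) ≤ (ℓ - 2) / 2 - j

/-- `G`, with its cycle of length `ℓ` labelled by `a`, is an odd-`(ℓ, j)` graph. -/
def IsOddGraph {V : Type*} (G : SimpleGraph V) {ℓ : ℕ} (a : ZMod ℓ → V) (j : ℕ) : Prop :=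
  Odd ℓ ∧ j ∈ Set.Icc 1 ((ℓ - 1) / 2) ∧
    (j = (ℓ - 1) / 2 ∨ (CondBad G a j ∧ CondTrivial G a j))

/-- `G`, with its cycle of length `ℓ` labelled by `a`, is an even-`(ℓ, j)` graph. -/
def IsEvenGraph {V : Type*} (G : SimpleGraph V) {ℓ : ℕ} (a : ZMod ℓ → V) (j : ℕ) : Prop :=
  Even ℓ ∧ j ∈ Set.Icc 1 ((ℓ - 1) / 2) ∧
    CondBad G a j ∧ CondTrivial G a j ∧ CondShort G a j

end UnicyclicDim

open UnicyclicDim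

/-! Give each vertex a height, its distance to the cycle, and a root, the cycle vertex from which
its tree hangs. Every edge off the cycle joins a vertex to its parent (`IsUnicyclic.adj_iff`), so
two vertices in different trees are at distance (sum of heights) + (distance of the roots around the
cycle), and a path entering a hanging subtree passes through its top vertex.

Pairs in one tree: the first vertices of two sibling threads look alike from outside both threads,
so a metric generator is branch-resolving and L(G) ≤ dim(G). It must also meet two trees, since a
single root cannot separate its two neighbours on the cycle. Conversely these two properties resolve
all pairs inside a common tree (`exists_dist_ne_of_rt_eq`).

Pairs in different trees become arithmetic of indices and heights (`Unresolved`). Landmarks at a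
geodesic triple resolve all of them (`false_of_triple`). Now take landmarks at indices 0 and j with
2j < ℓ and all others in between. An unresolved pair is then of one of three kinds: one vertex lies
high above an end; both lie beyond the ends, on a common stretch next to one end where d(0,·) -
d(j,·) is constant; or, for even ℓ only, a high vertex strictly between the ends is paired with one
beyond them. Conditions (i), (ii), (iii) exclude these kinds (`isMetricGenerator_of_graph`). When
one of them fails, a vertex just off the cycle, or one of critical height, is confused with a cycle
vertex (`graph_of_isMetricGenerator`). For odd ℓ and j = (ℓ-1)/2 none of the three kinds can occur.

Lower bounds beyond L(G) rest on the rigidity of minimum branch-resolving sets: they all have the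
same active vertices (`active_eq_of_min`), and each leaves some child of every bad vertex without a
landmark below it (`exists_unhit_of_isBad`). So whether a generator of size L(G) exists depends only
on the graph. Without a geodesic triple, a normal labelling puts all active vertices on less than
half the cycle, or there are just two antipodal ones (`normal_cases`). The upper bounds add cycle
vertices: one completes a triple when two trees are active; with a single root in use, two always
suffice, and one does for odd ℓ. -/

namespace UnicyclicDim

variable {V : Type*} {G : SimpleGraph V}

section

/-! ### Labellings of the cycle -/

namespace IsCycleLabelling

variable {ℓ : ℕ} {a : ZMod ℓ → V}

lemma neZero (ha : IsCycleLabelling G a) : NeZero ℓ := ⟨by have := ha.1; omega⟩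

lemma natCast_ne_zero (ha : IsCycleLabelling G a) {n : ℕ} (h0 : 0 < n) (hn : n < ℓ) :
    (n : ZMod ℓ) ≠ 0 := by
  have := ha.1
  rw [Ne, ZMod.natCast_eq_zero_iff]
  exact fun h => absurd (Nat.le_of_dvd h0 h) (by omega)

lemma reachable_deleteEdges (ha : IsCycleLabelling G a) (i : ZMod ℓ) {n : ℕ} (hn : n + 1 ≤ ℓ) :
    (G.deleteEdges {s(a i, a (i + 1))}).Reachable (a (i + 1)) (a (i + 1 + n)) := by
  have h3 := ha.1
  induction n with
  | zero => simp
  | succ n ih =>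
    refine (ih (by omega)).trans (SimpleGraph.Adj.reachable ?_)
    rw [SimpleGraph.deleteEdges_adj]
    have hadj := ha.2.2 (i + 1 + n)
    refine ⟨by simpa [add_assoc] using hadj, ?_⟩
    intro h
    rw [Set.mem_singleton_iff, Sym2.eq_iff] at h
    rcases h with ⟨h, -⟩ | ⟨h, h'⟩
    · have h1 := ha.2.1 h
      refine ha.natCast_ne_zero (n := n + 1) (by omega) (by omega) ?_
      push_cast
      linear_combination h1
    · have h1 := ha.2.1 h
      have h2 := ha.2.1 h'
      refine ha.natCast_ne_zero (n := 2) (by omega) (by omega) ?_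
      push_cast at h2 ⊢
      linear_combination h2 - h1

/-- Going round the labelling the other way joins the two ends, so the edge is not a bridge. -/
lemma edge_mem (ha : IsCycleLabelling G a) (i : ZMod ℓ) :
    s(a i, a (i + 1)) ∈ cycleEdges G := by
  by_contra hcon
  have h3 := ha.1
  have hb : G.IsBridge s(a i, a (i + 1)) := by
    rw [SimpleGraph.isBridge_iff_forall_cycle_notMem (ha.2.2 i)]
    exact fun u c hc he => hcon ⟨u, c, hc, he⟩
  rw [SimpleGraph.isBridge_iff] at hb
  apply hb
  have h := ha.reachable_deleteEdges i (n := ℓ - 1) (by omega)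
  have : i + 1 + ((ℓ - 1 : ℕ) : ZMod ℓ) = i := by
    rw [Nat.cast_sub (by omega)]; simp
  rw [this] at h
  exact h.symm

lemma edge_injective (ha : IsCycleLabelling G a) :
    Function.Injective fun i => s(a i, a (i + 1)) := by
  intro i j h
  rcases Sym2.eq_iff.1 h with ⟨h, -⟩ | ⟨h, h'⟩
  · exact ha.2.1 h
  · have h1 := ha.2.1 h
    have h2 := ha.2.1 h'
    refine absurd ?_ (ha.natCast_ne_zero (n := 2) (by omega) (by have := ha.1; omega))
    push_cast
    linear_combination h2 - h1

/-- A labelling supplies ℓ distinct edges lying on cycles, and there are only ℓ of those. -/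
lemma cycleEdges_eq [Finite V] (ha : IsCycleLabelling G a) (hℓ : cycleLength G = ℓ) :
    cycleEdges G = Set.range fun i => s(a i, a (i + 1)) := by
  have := ha.neZero
  symm
  apply Set.eq_of_subset_of_ncard_le
  · rintro _ ⟨i, rfl⟩
    exact ha.edge_mem i
  · rw [← Set.image_univ, Set.ncard_image_of_injective _ ha.edge_injective, Set.ncard_univ,
      Nat.card_zmod]
    exact hℓ.le
  · exact Set.toFinite _

end IsCycleLabelling

lemma mem_cycleVerts_iff {v : V} : v ∈ cycleVerts G ↔ ∃ e ∈ cycleEdges G, v ∈ e := by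
  constructor
  · rintro ⟨u, c, hc, hv⟩
    obtain ⟨e, he, hve⟩ :=
      (SimpleGraph.Walk.mem_support_iff_exists_mem_edges_of_not_nil hc.not_nil).1 hv
    exact ⟨e, ⟨u, c, hc, he⟩, hve⟩
  · rintro ⟨e, ⟨u, c, hc, he⟩, hve⟩
    refine ⟨u, c, hc, ?_⟩
    induction e with | h x y =>
    rcases Sym2.mem_iff.1 hve with rfl | rfl
    · exact c.fst_mem_support_of_mem_edges he
    · exact c.snd_mem_support_of_mem_edges he

lemma IsCycleLabelling.cycleVerts_eq [Finite V] {ℓ : ℕ} {a : ZMod ℓ → V}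
    (ha : IsCycleLabelling G a) (hℓ : cycleLength G = ℓ) : cycleVerts G = Set.range a := by
  ext v
  rw [mem_cycleVerts_iff, ha.cycleEdges_eq hℓ]
  constructor
  · rintro ⟨_, ⟨i, rfl⟩, h⟩
    rcases Sym2.mem_iff.1 h with rfl | rfl
    exacts [⟨i, rfl⟩, ⟨i + 1, rfl⟩]
  · rintro ⟨i, rfl⟩
    exact ⟨_, ⟨i, rfl⟩, Sym2.mem_mk_left _ _⟩

lemma IsUnicyclic.exists_labelling [Finite V] (hG : IsUnicyclic G) {ℓ : ℕ}
    (hℓ : cycleLength G = ℓ) : ∃ a : ZMod ℓ → V, IsCycleLabelling G a := by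
  obtain ⟨-, E, ⟨u, c, hc, rfl⟩, huniq⟩ := hG
  have hE : cycleEdges G = {e | e ∈ c.edges} := by
    ext e
    constructor
    · rintro ⟨u', c', hc', he⟩
      rw [← huniq {e | e ∈ c'.edges} ⟨u', c', hc', rfl⟩]
      exact he
    · exact fun he => ⟨u, c, hc, he⟩
  have hlen : c.length = ℓ := by
    classical
    rw [← hℓ, cycleLength, hE, ← c.length_edges, ← List.toFinset_card_of_nodup hc.edges_nodup,
      ← Set.ncard_coe_finset]
    congr 1
    ext; simp
  subst hlen
  have h3 := hc.three_le_length
  have : NeZero c.length := ⟨by omega⟩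
  refine ⟨fun i => c.getVert i.val, h3, ?_, ?_⟩
  · intro i j hij
    have hi := i.val_lt
    have hj := j.val_lt
    exact ZMod.val_injective _ (hc.getVert_injOn' (by simp; omega) (by simp; omega) hij)
  · intro i
    have hi := i.val_lt
    have h := c.adj_getVert_succ hi
    have h1 : (1 : ZMod c.length).val = 1 := by
      have := ZMod.val_natCast_of_lt (n := c.length) (a := 1) (by omega)
      simpa using this
    by_cases hlt : i.val + 1 < c.length
    · have : (i + 1).val = i.val + 1 := by
        rw [ZMod.val_add_of_lt (by rw [h1]; exact hlt), h1]
      simpa [this] using h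
    · have hil : i.val + 1 = c.length := by omega
      have : (i + 1).val = 0 := by
        rw [ZMod.val_add, h1, hil, Nat.mod_self]
      simp only [this]
      rw [hil] at h
      simpa using h

/-! ### Heights and parents -/

/-- The distance from `v` to the cycle. -/
noncomputable def ht (G : SimpleGraph V) (v : V) : ℕ :=
  sInf {n | ∃ c ∈ cycleVerts G, G.dist v c = n}

open Classical in
/-- The neighbour of `v` that is closer to the cycle; `v` itself if `v` lies on the cycle. -/
noncomputable def par (G : SimpleGraph V) (v : V) : V :=
  if h : ∃ u, G.Adj v u ∧ ht G u + 1 = ht G v then h.choose else v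

lemma IsUnicyclic.cycleVerts_nonempty (hG : IsUnicyclic G) : (cycleVerts G).Nonempty := by
  obtain ⟨-, E, ⟨u, c, hc, rfl⟩, -⟩ := hG
  exact ⟨u, u, c, hc, c.start_mem_support⟩

lemma ht_le {v c : V} (hc : c ∈ cycleVerts G) : ht G v ≤ G.dist v c :=
  Nat.sInf_le ⟨c, hc, rfl⟩

lemma IsUnicyclic.exists_dist_eq_ht (hG : IsUnicyclic G) (v : V) :
    ∃ c ∈ cycleVerts G, G.dist v c = ht G v := by
  obtain ⟨c, hc⟩ := hG.cycleVerts_nonempty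
  exact Nat.sInf_mem (s := {n | ∃ c ∈ cycleVerts G, G.dist v c = n}) ⟨_, c, hc, rfl⟩

lemma IsUnicyclic.ht_eq_zero (hG : IsUnicyclic G) {v : V} : ht G v = 0 ↔ v ∈ cycleVerts G := by
  constructor
  · intro h
    obtain ⟨c, hc, hd⟩ := hG.exists_dist_eq_ht v
    rw [h, hG.1.dist_eq_zero_iff] at hd
    exact hd ▸ hc
  · intro h
    have := ht_le (v := v) h
    simpa using this

lemma IsUnicyclic.ht_le_dist_add (hG : IsUnicyclic G) (u v : V) :
    ht G u ≤ G.dist u v + ht G v := by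
  obtain ⟨c, hc, hd⟩ := hG.exists_dist_eq_ht v
  rw [← hd]
  exact (ht_le hc).trans hG.1.dist_triangle

lemma IsUnicyclic.par_spec (hG : IsUnicyclic G) {v : V} (hv : 0 < ht G v) :
    G.Adj v (par G v) ∧ ht G (par G v) + 1 = ht G v := by
  have h : ∃ u, G.Adj v u ∧ ht G u + 1 = ht G v := by
    obtain ⟨c, hc, hd⟩ := hG.exists_dist_eq_ht v
    obtain ⟨p, hp⟩ := hG.1.exists_walk_length_eq_dist v c
    cases p with
    | nil => simp at hd; omega
    | @cons _ u _ hadj q =>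
      refine ⟨u, hadj, ?_⟩
      have h1 := (ht_le (v := u) hc).trans (SimpleGraph.dist_le q)
      have h2 := hG.ht_le_dist_add v u
      rw [SimpleGraph.dist_eq_one_iff_adj.2 hadj] at h2
      simp only [SimpleGraph.Walk.length_cons] at hp
      omega
  rw [par, dif_pos h]
  exact h.choose_spec

lemma par_of_ht_eq_zero {v : V} (hv : ht G v = 0) : par G v = v := by
  rw [par, dif_neg]
  rintro ⟨u, -, h⟩
  omega

lemma IsUnicyclic.cycle_reachable [Finite V] (hG : IsUnicyclic G) {e : Sym2 V}
    (he : e ∉ cycleEdges G) {u v : V} (hu : u ∈ cycleVerts G) (hv : v ∈ cycleVerts G) :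
    (G.deleteEdges {e}).Reachable u v := by
  obtain ⟨a, ha⟩ := hG.exists_labelling rfl
  have := ha.neZero
  rw [ha.cycleVerts_eq rfl] at hu hv
  have key : ∀ i n, (G.deleteEdges {e}).Reachable (a i) (a (i + (n : ℕ))) := by
    intro i n
    induction n with
    | zero => simp
    | succ n ih =>
      refine ih.trans (SimpleGraph.Adj.reachable ?_)
      rw [SimpleGraph.deleteEdges_adj]
      refine ⟨by simpa [add_assoc] using ha.2.2 (i + n), fun h => he ?_⟩
      rw [Set.mem_singleton_iff] at h
      rw [← h]
      simpa [add_assoc] using ha.edge_mem (i + n)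
  obtain ⟨i, rfl⟩ := hu
  obtain ⟨j, rfl⟩ := hv
  have := key i (j - i).val
  simpa using this

lemma mem_cycleEdges_of_reachable {u v : V} (h : G.Adj u v)
    (hr : (G.deleteEdges {s(u, v)}).Reachable u v) : s(u, v) ∈ cycleEdges G := by
  by_contra hcon
  have hb : G.IsBridge s(u, v) := by
    rw [SimpleGraph.isBridge_iff_forall_cycle_notMem h]
    exact fun u c hc he => hcon ⟨u, c, hc, he⟩
  exact (SimpleGraph.isBridge_iff.1 hb) hr

/-- If an edge were of none of these kinds, then after deleting it both ends could still climb to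
the cycle along parents and be joined there, so the edge would lie on a cycle after all. -/
lemma IsUnicyclic.adj_iff [Finite V] (hG : IsUnicyclic G) {u v : V} :
    G.Adj u v ↔ s(u, v) ∈ cycleEdges G ∨ (0 < ht G u ∧ par G u = v) ∨
      (0 < ht G v ∧ par G v = u) := by
  constructor
  · intro h
    by_contra! hcon
    obtain ⟨h1, h2, h3⟩ := hcon
    have key : ∀ n z, ht G z = n →
        ∃ c ∈ cycleVerts G, (G.deleteEdges {s(u, v)}).Reachable z c := by
      intro n
      induction n with
      | zero => exact fun z hz => ⟨z, hG.ht_eq_zero.1 hz, .rfl⟩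
      | succ n ih =>
        intro z hz
        obtain ⟨hadj, hp⟩ := hG.par_spec (v := z) (by omega)
        obtain ⟨c, hc, hr⟩ := ih (par G z) (by omega)
        refine ⟨c, hc, SimpleGraph.Reachable.trans (SimpleGraph.Adj.reachable ?_) hr⟩
        rw [SimpleGraph.deleteEdges_adj]
        refine ⟨hadj, fun he => ?_⟩
        rcases Sym2.eq_iff.1 (Set.mem_singleton_iff.1 he) with ⟨rfl, h'⟩ | ⟨rfl, h'⟩
        · exact h2 (by omega) h'
        · exact h3 (by omega) h'
    obtain ⟨c, hc, hr⟩ := key _ u rfl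
    obtain ⟨c', hc', hr'⟩ := key _ v rfl
    exact h1 (mem_cycleEdges_of_reachable h
      (hr.trans ((hG.cycle_reachable h1 hc hc').trans hr'.symm)))
  · rintro (⟨w, c, hc, he⟩ | ⟨h, rfl⟩ | ⟨h, rfl⟩)
    · exact c.adj_of_mem_edges he
    · exact (hG.par_spec h).1
    · exact (hG.par_spec h).1.symm

lemma IsUnicyclic.ht_of_mem_cycleEdges (hG : IsUnicyclic G) {u v : V}
    (h : s(u, v) ∈ cycleEdges G) : ht G u = 0 ∧ ht G v = 0 :=
  ⟨hG.ht_eq_zero.2 (mem_cycleVerts_iff.2 ⟨_, h, Sym2.mem_mk_left _ _⟩),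
    hG.ht_eq_zero.2 (mem_cycleVerts_iff.2 ⟨_, h, Sym2.mem_mk_right _ _⟩)⟩

end

/-! ### Roots, descendants and children -/

section

/-- The vertex of the cycle from which the tree containing `v` hangs. -/
noncomputable def rt (G : SimpleGraph V) (v : V) : V := (par G)^[ht G v] v

/-- `z` is a descendant of `w`: one of the iterated parents of `z` is `w`. -/
def IsDesc (G : SimpleGraph V) (w z : V) : Prop := ∃ n, (par G)^[n] z = w

/-- The vertices off the cycle whose parent is `v`. -/
def children (G : SimpleGraph V) (v : V) : Set V := {w | 0 < ht G w ∧ par G w = v}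

namespace IsUnicyclic

lemma ht_par (hG : IsUnicyclic G) (z : V) : ht G (par G z) = ht G z - 1 := by
  rcases Nat.eq_zero_or_pos (ht G z) with h | h
  · rw [par_of_ht_eq_zero h, h]
  · have := (hG.par_spec h).2
    omega

lemma ht_iterate (hG : IsUnicyclic G) (n : ℕ) (z : V) :
    ht G ((par G)^[n] z) = ht G z - n := by
  induction n with
  | zero => simp
  | succ n ih => rw [Function.iterate_succ_apply', hG.ht_par, ih]; omega

lemma ht_rt (hG : IsUnicyclic G) (z : V) : ht G (rt G z) = 0 := by
  rw [rt, hG.ht_iterate]; omega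

end IsUnicyclic

lemma rt_of_ht_eq_zero {z : V} (h : ht G z = 0) : rt G z = z := by
  rw [rt, h]; rfl

namespace IsUnicyclic

lemma rt_par (hG : IsUnicyclic G) (z : V) : rt G (par G z) = rt G z := by
  rcases Nat.eq_zero_or_pos (ht G z) with h | h
  · rw [par_of_ht_eq_zero h]
  · have : ht G z = ht G (par G z) + 1 := by rw [hG.ht_par]; omega
    conv_rhs => rw [rt, this, Function.iterate_succ_apply]
    rfl

lemma rt_mem (hG : IsUnicyclic G) (z : V) : rt G z ∈ cycleVerts G :=
  hG.ht_eq_zero.1 (hG.ht_rt z)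

end IsUnicyclic

lemma IsDesc.refl (z : V) : IsDesc G z z := ⟨0, rfl⟩

lemma isDesc_rt (z : V) : IsDesc G (rt G z) z := ⟨_, rfl⟩

lemma IsDesc.trans {w x z : V} (h : IsDesc G w x) (h' : IsDesc G x z) : IsDesc G w z := by
  obtain ⟨n, rfl⟩ := h
  obtain ⟨m, rfl⟩ := h'
  exact ⟨n + m, Function.iterate_add_apply _ _ _ _⟩

lemma isDesc_par (z : V) : IsDesc G (par G z) z := ⟨1, rfl⟩

lemma IsDesc.eq_or {w z : V} (h : IsDesc G w z) : z = w ∨ IsDesc G w (par G z) := by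
  obtain ⟨n, hn⟩ := h
  cases n with
  | zero => exact .inl hn
  | succ n => exact .inr ⟨n, hn⟩

namespace IsUnicyclic

lemma ht_le_of_isDesc (hG : IsUnicyclic G) {w z : V} (h : IsDesc G w z) : ht G w ≤ ht G z := by
  obtain ⟨n, rfl⟩ := h
  rw [hG.ht_iterate]; omega

lemma rt_eq_of_isDesc (hG : IsUnicyclic G) {w z : V} (h : IsDesc G w z) : rt G w = rt G z := by
  obtain ⟨n, rfl⟩ := h
  induction n with
  | zero => rfl
  | succ n ih => rw [Function.iterate_succ_apply', hG.rt_par, ih]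

lemma eq_of_isDesc_of_ht_eq (hG : IsUnicyclic G) {w z : V} (h : IsDesc G w z)
    (hh : ht G z ≤ ht G w) : z = w := by
  obtain ⟨n, rfl⟩ := h
  rw [hG.ht_iterate] at hh
  rcases Nat.eq_zero_or_pos n with rfl | hn
  · rfl
  · have h0 : ht G z = 0 := by omega
    have : Function.IsFixedPt (par G) z := par_of_ht_eq_zero h0
    exact (this.iterate n).symm

lemma isDesc_of_ht_le (hG : IsUnicyclic G) {w w' z : V} (h : IsDesc G w z) (h' : IsDesc G w' z)
    (hh : ht G w ≤ ht G w') : IsDesc G w w' := by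
  obtain ⟨n, rfl⟩ := h
  obtain ⟨m, rfl⟩ := h'
  rcases le_total m n with hmn | hmn
  · exact ⟨n - m, by rw [← Function.iterate_add_apply]; congr 1; omega⟩
  -- More iterations need not lower the height, since `par` fixes the cycle; but here the heights
  -- are forced to agree and the two vertices coincide.
  · have h1 : IsDesc G ((par G)^[m] z) ((par G)^[n] z) :=
      ⟨m - n, by rw [← Function.iterate_add_apply]; congr 1; omega⟩
    have := hG.eq_of_isDesc_of_ht_eq h1 hh
    rw [this]
    exact .refl _

lemma eq_of_isDesc (hG : IsUnicyclic G) {w w' z : V} (h : IsDesc G w z) (h' : IsDesc G w' z)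
    (hh : ht G w = ht G w') : w = w' :=
  (hG.eq_of_isDesc_of_ht_eq (hG.isDesc_of_ht_le h h' hh.le) hh.ge).symm

lemma ht_of_mem_children (hG : IsUnicyclic G) {v w : V} (h : w ∈ children G v) :
    ht G w = ht G v + 1 := by
  rw [← h.2, hG.ht_par]
  have := h.1
  omega

lemma rt_of_mem_children (hG : IsUnicyclic G) {v w : V} (h : w ∈ children G v) :
    rt G w = rt G v := by
  rw [← h.2, hG.rt_par]

lemma eq_of_mem_children (hG : IsUnicyclic G) {v w w' z : V} (hw : w ∈ children G v)
    (hw' : w' ∈ children G v) (h : IsDesc G w z) (h' : IsDesc G w' z) : w = w' :=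
  hG.eq_of_isDesc h h' (by rw [hG.ht_of_mem_children hw, hG.ht_of_mem_children hw'])

lemma exists_child (hG : IsUnicyclic G) {v z : V} (h : IsDesc G v z) (hh : ht G v < ht G z) :
    ∃ w ∈ children G v, IsDesc G w z := by
  obtain ⟨n, hn⟩ := h
  induction n generalizing z with
  | zero => simp at hn; subst hn; omega
  | succ n ih =>
    have hd : IsDesc G v (par G z) := ⟨n, hn⟩
    by_cases hlt : ht G v < ht G (par G z)
    · obtain ⟨w, hw, hwz⟩ := ih hlt hn
      exact ⟨w, hw, hwz.trans (isDesc_par z)⟩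
    · exact ⟨z, ⟨by omega, hG.eq_of_isDesc_of_ht_eq hd (by omega)⟩, .refl z⟩

lemma isDesc_of_mem_children {v w : V} (h : w ∈ children G v) : IsDesc G v w :=
  h.2 ▸ isDesc_par w

end IsUnicyclic

/-! ### Distances -/

/-- Lower bounds on distances are obtained by exhibiting a potential that grows by at most one along
each edge. -/
lemma le_add_dist (hG : G.Connected) {φ : V → ℕ}
    (hφ : ∀ u v, G.Adj u v → φ v ≤ φ u + 1) (x y : V) : φ y ≤ φ x + G.dist x y := by
  obtain ⟨p, hp⟩ := hG.exists_walk_length_eq_dist x y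
  rw [← hp]
  clear hp
  induction p with
  | nil => simp
  | cons h p ih =>
    have := hφ _ _ h
    rw [SimpleGraph.Walk.length_cons]
    omega

namespace IsUnicyclic

lemma ht_le_add_one (hG : IsUnicyclic G) {u v : V} (h : G.Adj u v) : ht G v ≤ ht G u + 1 := by
  have := hG.ht_le_dist_add v u
  rw [SimpleGraph.dist_eq_one_iff_adj.2 h.symm] at this
  omega

lemma dist_par_le (hG : IsUnicyclic G) (z : V) : G.dist z (par G z) ≤ 1 := by
  rcases Nat.eq_zero_or_pos (ht G z) with h | h
  · rw [par_of_ht_eq_zero h]; simp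
  · rw [SimpleGraph.dist_eq_one_iff_adj.2 (hG.par_spec h).1]

lemma dist_of_isDesc (hG : IsUnicyclic G) {s z : V} (h : IsDesc G z s) :
    G.dist s z + ht G z = ht G s := by
  apply le_antisymm
  · obtain ⟨n, hn⟩ := h
    induction n generalizing s with
    | zero => simp at hn; subst hn; simp
    | succ n ih =>
      have h1 := ih hn
      have h2 := hG.1.dist_triangle (u := s) (v := par G s) (w := z)
      have h3 := hG.dist_par_le s
      have h4 := hG.ht_par s
      rcases Nat.eq_zero_or_pos (ht G s) with h | h
      · rw [par_of_ht_eq_zero h] at h1; exact h1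
      · omega
  · exact hG.ht_le_dist_add s z

lemma dist_le_of_common (hG : IsUnicyclic G) {s x w : V} (hs : IsDesc G w s)
    (hx : IsDesc G w x) : G.dist s x + 2 * ht G w ≤ ht G s + ht G x := by
  have h1 := hG.dist_of_isDesc hs
  have h2 := hG.dist_of_isDesc hx
  have h3 := hG.1.dist_triangle (u := s) (v := w) (w := x)
  rw [SimpleGraph.dist_comm (u := w)] at h3
  omega

variable [Finite V]

/-- The subtree below `z` is joined to the rest of the graph only by the edge from `z` to its
parent. -/
lemma dist_eq_dist_par_add_one (hG : IsUnicyclic G) {s z : V} (hz : 0 < ht G z)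
    (hs : ¬ IsDesc G z s) : G.dist s z = G.dist s (par G z) + 1 := by
  classical
  apply le_antisymm
  · have h1 := hG.1.dist_triangle (u := s) (v := par G z) (w := z)
    have h2 := hG.dist_par_le z
    rw [SimpleGraph.dist_comm] at h2
    omega
  -- The potential is the distance from `s` outside the subtree, and the conjectured distance
  -- through the parent of `z` inside it; only edges crossing the boundary need the edge
  -- classification.
  have h := le_add_dist hG.1 (φ := fun x => if IsDesc G z x then
    G.dist s (par G z) + 1 + (ht G x - ht G z) else G.dist s x) ?_ s z
  · simp only [if_neg hs, IsDesc.refl, if_true, SimpleGraph.dist_self] at h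
    omega
  intro u v huv
  have hl : G.dist s v ≤ G.dist s u + 1 := by
    have h1 := hG.1.dist_triangle (u := s) (v := u) (w := v)
    rw [SimpleGraph.dist_eq_one_iff_adj.2 huv] at h1
    exact h1
  have hht := hG.ht_le_add_one huv
  by_cases hu : IsDesc G z u <;> by_cases hv : IsDesc G z v
  · simp only [hu, hv, if_true]; omega
  · simp only [hu, hv, if_true, if_false]
    rcases hG.adj_iff.1 huv with h | ⟨h, rfl⟩ | ⟨h, rfl⟩
    · have := hG.ht_of_mem_cycleEdges h
      have := hG.ht_le_of_isDesc hu
      omega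
    · rcases hu.eq_or with rfl | h'
      · omega
      · exact absurd h' hv
    · exact absurd (hu.trans (isDesc_par v)) hv
  · simp only [hu, hv, if_true, if_false]
    rcases hG.adj_iff.1 huv with h | ⟨h, rfl⟩ | ⟨h, rfl⟩
    · have := hG.ht_of_mem_cycleEdges h
      have := hG.ht_le_of_isDesc hv
      omega
    · exact absurd (hv.trans (isDesc_par u)) hu
    · rcases hv.eq_or with rfl | h'
      · omega
      · exact absurd h' hu
  · simp only [hu, hv, if_false]; exact hl

lemma dist_of_not_isDesc (hG : IsUnicyclic G) {s w z : V} (hw : 0 < ht G w) (hz : IsDesc G w z)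
    (hs : ¬ IsDesc G w s) : G.dist s z + ht G w = G.dist s (par G w) + 1 + ht G z := by
  obtain ⟨n, hn⟩ := hz
  induction n generalizing z with
  | zero =>
    simp at hn; subst hn
    rw [hG.dist_eq_dist_par_add_one hw hs]
  | succ n ih =>
    have h1 := ih hn
    have hd : IsDesc G w (par G z) := ⟨n, hn⟩
    have hwz := hG.ht_le_of_isDesc (hd.trans (isDesc_par z))
    have h2 := hG.dist_eq_dist_par_add_one (s := s) (z := z) (by omega)
      (fun h => hs ((hd.trans (isDesc_par z)).trans h))
    have h4 := hG.ht_par z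
    omega

lemma dist_of_rt_ne (hG : IsUnicyclic G) {s x : V} (h : rt G s ≠ rt G x) :
    G.dist s x = G.dist s (rt G x) + ht G x := by
  induction hn : ht G x generalizing x with
  | zero => rw [rt_of_ht_eq_zero hn]; rfl
  | succ n ih =>
    rw [← hG.rt_par x] at h
    have := ih h (by rw [hG.ht_par]; omega)
    rw [hG.dist_eq_dist_par_add_one (by omega) (fun hd => h ?_), this, hG.rt_par]
    · omega
    · rw [hG.rt_par, hG.rt_eq_of_isDesc hd]

lemma dist_cycle (hG : IsUnicyclic G) {s c : V} (hc : ht G c = 0) :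
    G.dist s c = ht G s + G.dist (rt G s) c := by
  by_cases h : rt G s = c
  · subst h
    have := hG.dist_of_isDesc (isDesc_rt (G := G) s)
    simp [hG.ht_rt] at this ⊢
    exact this
  · have := hG.dist_of_rt_ne (s := c) (x := s) (by rw [rt_of_ht_eq_zero hc]; exact Ne.symm h)
    rw [SimpleGraph.dist_comm, this, SimpleGraph.dist_comm, add_comm]

lemma dist_le_ht_add (hG : IsUnicyclic G) {s x : V} (h : rt G s = rt G x) :
    G.dist s x ≤ ht G s + ht G x := by
  have h1 := hG.dist_cycle (s := s) (c := rt G x) (hG.ht_rt x)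
  have h2 := hG.dist_cycle (s := x) (c := rt G x) (hG.ht_rt x)
  rw [h] at h1
  simp only [SimpleGraph.dist_self] at h1 h2
  have h3 := hG.1.dist_triangle (u := s) (v := rt G x) (w := x)
  rw [SimpleGraph.dist_comm (u := rt G x)] at h3
  omega

/-! ### Degrees -/

lemma deg_of_ht_pos (hG : IsUnicyclic G) {v : V} (hv : 0 < ht G v) :
    deg G v = (children G v).ncard + 1 := by
  have : G.neighborSet v = insert (par G v) (children G v) := by
    ext w
    rw [SimpleGraph.mem_neighborSet, hG.adj_iff, Set.mem_insert_iff]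
    constructor
    · rintro (h | ⟨-, h⟩ | h)
      · have := hG.ht_of_mem_cycleEdges h; omega
      · exact .inl h.symm
      · exact .inr h
    · rintro (h | h)
      · exact .inr (.inl ⟨hv, h.symm⟩)
      · exact .inr (.inr h)
  rw [deg, this, Set.ncard_insert_of_notMem]
  intro h
  have := hG.ht_of_mem_children h
  rw [hG.ht_par] at this
  omega

lemma deg_of_ht_eq_zero (hG : IsUnicyclic G) {v : V} (hv : ht G v = 0) :
    deg G v = (children G v).ncard + 2 := by
  obtain ⟨a, ha⟩ := hG.exists_labelling rfl
  have hv' := hG.ht_eq_zero.1 hv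
  rw [ha.cycleVerts_eq rfl] at hv'
  obtain ⟨i, rfl⟩ := hv'
  have hne : a (i + 1) ≠ a (i - 1) := by
    intro h
    have h1 := ha.2.1 h
    refine absurd ?_ (ha.natCast_ne_zero (n := 2) (by omega) (by have := ha.1; omega))
    push_cast
    linear_combination h1
  have : G.neighborSet (a i) = {a (i + 1), a (i - 1)} ∪ children G (a i) := by
    ext w
    rw [SimpleGraph.mem_neighborSet, hG.adj_iff, ha.cycleEdges_eq rfl]
    constructor
    · rintro (⟨j, h⟩ | ⟨h, -⟩ | h)
      · rcases Sym2.eq_iff.1 h with ⟨h1, h2⟩ | ⟨h1, h2⟩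
        · have := ha.2.1 h1
          subst this
          exact .inl (.inl h2.symm)
        · have := ha.2.1 h2
          subst this
          exact .inl (.inr (by simp [h1]))
      · omega
      · exact .inr h
    · rintro ((rfl | rfl) | h)
      · exact .inl ⟨i, rfl⟩
      · exact .inl ⟨i - 1, by simp [Sym2.eq_swap]⟩
      · exact .inr (.inr h)
  rw [deg, this, Set.ncard_union_eq, Set.ncard_pair hne, add_comm]
  rw [Set.disjoint_left]
  rintro x hx hx'
  have h0 : ht G x = 0 := by
    rw [hG.ht_eq_zero, ha.cycleVerts_eq rfl]
    rcases hx with rfl | rfl <;> exact ⟨_, rfl⟩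
  have := hx'.1
  omega

end IsUnicyclic

end

section

/-! ### Threads -/

/-- `w` lies off the cycle and its descendants form a path. -/
def IsThreadRoot (G : SimpleGraph V) (w : V) : Prop :=
  0 < ht G w ∧ ∀ z, IsDesc G w z → deg G z ≤ 2

/-- A path off the cycle that descends from its first vertex to a vertex of degree `1`. -/
inductive IsDownPath (G : SimpleGraph V) : List V → Prop
  | single (w : V) (h0 : 0 < ht G w) (hd : deg G w = 1) : IsDownPath G [w]
  | cons (w x : V) (l : List V) (h0 : 0 < ht G w) (hd : deg G w = 2) (hx : par G x = w)
      (hl : IsDownPath G (x :: l)) : IsDownPath G (w :: x :: l)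

lemma IsDownPath.ht_pos {w : V} {l : List V} (h : IsDownPath G (w :: l)) : 0 < ht G w := by
  cases h <;> assumption

namespace IsUnicyclic

lemma eq_or_child_isDesc (hG : IsUnicyclic G) {w z : V} (h : IsDesc G w z) :
    z = w ∨ ∃ x ∈ children G w, IsDesc G x z := by
  by_cases hh : ht G w < ht G z
  · exact .inr (hG.exists_child h hh)
  · exact .inl (hG.eq_of_isDesc_of_ht_eq h (by omega))

lemma isDownPath_deg {w : V} {t : List V} (h : IsDownPath G (w :: t)) :
    ∀ z ∈ w :: t, deg G z ≤ 2 := by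
  induction t generalizing w with
  | nil =>
    cases h with | single _ h0 hd =>
    intro z hz
    rw [List.mem_singleton] at hz
    subst hz; omega
  | cons x t ih =>
    cases h with | cons _ _ _ h0 hd hx hl =>
    intro z hz
    rcases List.mem_cons.1 hz with rfl | hz
    · omega
    · exact ih hl z hz

variable [Finite V]

lemma children_eq_empty (hG : IsUnicyclic G) {w : V} (hd : deg G w = 1) : children G w = ∅ := by
  rcases Nat.eq_zero_or_pos (ht G w) with h | h
  · have := hG.deg_of_ht_eq_zero h; omega
  · have := hG.deg_of_ht_pos h
    rw [← Set.ncard_eq_zero]; omega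

lemma ht_pos_of_deg_one (hG : IsUnicyclic G) {w : V} (hd : deg G w = 1) : 0 < ht G w := by
  rcases Nat.eq_zero_or_pos (ht G w) with h | h
  · have := hG.deg_of_ht_eq_zero h; omega
  · exact h

lemma ncard_children_pos {v w : V} (h : w ∈ children G v) : 0 < (children G v).ncard :=
  (Set.ncard_pos (Set.toFinite _)).2 ⟨w, h⟩

lemma eq_child_of_deg_two (hG : IsUnicyclic G) {w x y : V} (h0 : 0 < ht G w) (hd : deg G w ≤ 2)
    (hx : x ∈ children G w) (hy : y ∈ children G w) : x = y := by
  have := hG.deg_of_ht_pos h0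
  exact (Set.ncard_le_one (Set.toFinite _)).1 (by omega) x hx y hy

/-- Argue from the leaf backwards: the leaf has no child, so its predecessor is its parent; an inner
vertex has degree 2 and its successor as child, so its predecessor must be its parent. -/
lemma isDownPath_of_chain (hG : IsUnicyclic G) {v : V} {l : List V} (hne : l ≠ [])
    (hnd : (v :: l).Nodup) (hch : (v :: l).IsChain G.Adj) (hin : ∀ x ∈ l.dropLast, deg G x = 2)
    (hla : ∀ x ∈ l.getLast?, deg G x = 1) :
    ∃ w t, l = w :: t ∧ par G w = v ∧ IsDownPath G (w :: t) := by
  induction l generalizing v with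
  | nil => exact absurd rfl hne
  | cons w t ih =>
    refine ⟨w, t, rfl, ?_⟩
    have hadj : G.Adj v w := by
      rw [List.isChain_cons_cons] at hch; exact hch.1
    cases t with
    | nil =>
      have hd : deg G w = 1 := hla w (by simp)
      have h0 := hG.ht_pos_of_deg_one hd
      refine ⟨?_, .single w h0 hd⟩
      rcases hG.adj_iff.1 hadj with h | h | h
      · have := hG.ht_of_mem_cycleEdges h; omega
      · have hw : v ∈ children G w := h
        rw [hG.children_eq_empty hd] at hw
        exact absurd hw (Set.notMem_empty _)
      · exact h.2
    | cons x t =>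
      obtain ⟨w', t', heq, hp, hD⟩ := ih (v := w) (by simp) (List.nodup_cons.1 hnd).2
        (by rw [List.isChain_cons_cons] at hch; exact hch.2)
        (fun y hy => hin y (by simp [List.dropLast, hy])) (fun y hy => hla y (by simpa using hy))
      obtain ⟨rfl, rfl⟩ := List.cons.inj heq
      have hd : deg G w = 2 := hin w (by simp [List.dropLast])
      have hxw : x ∈ children G w := ⟨hD.ht_pos, hp⟩
      have h0 : 0 < ht G w := by
        rcases Nat.eq_zero_or_pos (ht G w) with h | h
        · have := hG.deg_of_ht_eq_zero h
          have := ncard_children_pos hxw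
          omega
        · exact h
      refine ⟨?_, .cons w x t h0 hd hp hD⟩
      rcases hG.adj_iff.1 hadj with h | h | h
      · have := hG.ht_of_mem_cycleEdges h; omega
      · have := hG.eq_child_of_deg_two h0 hd.le h hxw
        subst this
        simp at hnd
      · exact h.2

lemma mem_isDownPath (hG : IsUnicyclic G) {w : V} {t : List V} (h : IsDownPath G (w :: t))
    {z : V} : z ∈ w :: t ↔ IsDesc G w z := by
  induction t generalizing w with
  | nil =>
    cases h with | single _ h0 hd =>
    rw [List.mem_singleton]
    refine ⟨fun h => h ▸ .refl _, fun h => ?_⟩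
    rcases hG.eq_or_child_isDesc h with h | ⟨x, hx, -⟩
    · exact h
    · rw [hG.children_eq_empty hd] at hx
      exact absurd hx (Set.notMem_empty _)
  | cons x t ih =>
    cases h with | cons _ _ _ h0 hd hx hl =>
    rw [List.mem_cons, ih hl]
    have hxw : x ∈ children G w := ⟨hl.ht_pos, hx⟩
    constructor
    · rintro (rfl | h)
      · exact .refl _
      · exact (isDesc_of_mem_children hxw).trans h
    · intro h
      rcases hG.eq_or_child_isDesc h with h | ⟨y, hy, hyz⟩
      · exact .inl h
      · exact .inr (hG.eq_child_of_deg_two h0 hd.le hxw hy ▸ hyz)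

lemma isThreadRoot_of_isDownPath (hG : IsUnicyclic G) {w : V} {t : List V}
    (h : IsDownPath G (w :: t)) : IsThreadRoot G w :=
  ⟨h.ht_pos, fun _ hz => isDownPath_deg h _ ((hG.mem_isDownPath h).2 hz)⟩

lemma isDownPath_unique (hG : IsUnicyclic G) {w : V} {t t' : List V}
    (h : IsDownPath G (w :: t)) (h' : IsDownPath G (w :: t')) : t = t' := by
  induction t generalizing w t' with
  | nil =>
    cases h with | single _ h0 hd =>
    cases h' with
    | single => rfl
    | cons _ _ _ _ hd' => omega
  | cons x t ih =>
    cases h with | cons _ _ _ h0 hd hx hl =>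
    cases h' with
    | single _ _ hd' => omega
    | cons _ y _ h0' hd' hy hl' =>
      have := hG.eq_child_of_deg_two h0 hd.le ⟨hl.ht_pos, hx⟩ ⟨hl'.ht_pos, hy⟩
      subst this
      rw [ih hl hl']

lemma exists_ht_bound : ∃ N, ∀ v, ht G v ≤ N := by
  obtain ⟨N, hN⟩ := (Set.finite_range (ht G)).bddAbove
  exact ⟨N, fun v => hN ⟨v, rfl⟩⟩

lemma exists_isDownPath (hG : IsUnicyclic G) {w : V} (h : IsThreadRoot G w) :
    ∃ t, IsDownPath G (w :: t) := by
  obtain ⟨N, hN⟩ := exists_ht_bound (G := G)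
  induction hn : N - ht G w generalizing w with
  | zero =>
    have h1 := h.2 w (.refl _)
    have h2 := hG.deg_of_ht_pos h.1
    have h3 : children G w = ∅ := by
      rw [Set.eq_empty_iff_forall_notMem]
      intro x hx
      have := hG.ht_of_mem_children hx
      have := hN x
      omega
    rw [h3, Set.ncard_empty] at h2
    exact ⟨[], .single w h.1 h2⟩
  | succ n ih =>
    have h1 := h.2 w (.refl _)
    have h2 := hG.deg_of_ht_pos h.1
    rcases Set.eq_empty_or_nonempty (children G w) with h3 | ⟨x, hx⟩
    · rw [h3, Set.ncard_empty] at h2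
      exact ⟨[], .single w h.1 h2⟩
    · have h4 := hG.ht_of_mem_children hx
      have h5 := ncard_children_pos hx
      obtain ⟨t, ht⟩ := ih (w := x)
        ⟨hx.1, fun z hz => h.2 z ((isDesc_of_mem_children hx).trans hz)⟩ (by omega)
      exact ⟨x :: t, .cons w x t h.1 (by omega) hx.2 ht⟩

lemma isDownPath_chain (hG : IsUnicyclic G) {w : V} {t : List V} (h : IsDownPath G (w :: t)) :
    (w :: t).Nodup ∧ (w :: t).IsChain G.Adj ∧ (∀ x ∈ (w :: t).dropLast, deg G x = 2) ∧
      ∀ x ∈ (w :: t).getLast?, deg G x = 1 := by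
  induction t generalizing w with
  | nil =>
    cases h with | single _ h0 hd =>
    simpa using hd
  | cons x t ih =>
    have hmem := fun z => hG.mem_isDownPath h (z := z)
    cases h with | cons _ _ _ h0 hd hx hl =>
    obtain ⟨h1, h2, h3, h4⟩ := ih hl
    have hxw : x ∈ children G w := ⟨hl.ht_pos, hx⟩
    refine ⟨?_, ?_, ?_, ?_⟩
    · rw [List.nodup_cons]
      refine ⟨fun hw => ?_, h1⟩
      rw [hG.mem_isDownPath hl] at hw
      have := hG.ht_le_of_isDesc hw
      have := hG.ht_of_mem_children hxw
      omega
    · rw [List.isChain_cons_cons]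
      exact ⟨hG.adj_iff.2 (.inr (.inr hxw)), h2⟩
    · intro y hy
      rw [List.dropLast_cons_of_ne_nil (by simp), List.mem_cons] at hy
      rcases hy with rfl | hy
      · exact hd
      · exact h3 y hy
    · intro y hy
      exact h4 y (by simpa using hy)

lemma isThread_iff (hG : IsUnicyclic G) {v : V} {l : List V} :
    IsThread G v l ↔ 3 ≤ deg G v ∧ ∃ w t, l = w :: t ∧ par G w = v ∧ IsDownPath G (w :: t) := by
  constructor
  · intro h
    refine ⟨h.three_le_deg, ?_⟩
    -- Vertices of a thread have degree at most 2, whereas `v` has degree at least 3.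
    have hv : v ∉ l := by
      intro hv
      have h3 := h.three_le_deg
      rw [← List.dropLast_append_getLast h.ne_nil, List.mem_append, List.mem_singleton] at hv
      rcases hv with h' | h'
      · have := h.deg_inner v h'; omega
      · have := h.deg_last v (by rw [h', List.getLast?_eq_getLast_of_ne_nil h.ne_nil]; simp)
        omega
    refine hG.isDownPath_of_chain h.ne_nil (List.nodup_cons.2 ⟨hv, h.nodup⟩) ?_ h.deg_inner
      h.deg_last
    rw [List.isChain_cons]
    exact ⟨h.adj_head, h.chain⟩
  · rintro ⟨h3, w, t, rfl, rfl, hD⟩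
    obtain ⟨h1, h2, h4, h5⟩ := hG.isDownPath_chain hD
    refine ⟨h3, by simp, h1, h2, ?_, h4, h5⟩
    intro x hx
    simp only [List.head?_cons, Option.mem_some_iff] at hx
    subst hx
    exact (hG.par_spec hD.ht_pos).1.symm

/-- A thread is determined by its first vertex. Finiteness is needed because `ncard` of an infinite
set of lists would be 0. -/
lemma threads_finite (hG : IsUnicyclic G) (v : V) : (threads G v).Finite := by
  apply Set.Finite.of_finite_image (f := List.head?) (Set.toFinite _)
  rintro l hl l' hl' h
  obtain ⟨-, w, t, rfl, -, hD⟩ := hG.isThread_iff.1 hl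
  obtain ⟨-, w', t', rfl, -, hD'⟩ := hG.isThread_iff.1 hl'
  simp only [List.head?_cons, Option.some.injEq] at h
  subst h
  rw [hG.isDownPath_unique hD hD']

lemma isBad_iff (hG : IsUnicyclic G) {v : V} :
    IsBad G v ↔ v ∈ cycleVerts G ∧ 4 ≤ deg G v ∧ ∃ w ∈ children G v, IsThreadRoot G w := by
  refine and_congr_right fun hv => and_congr_right fun hd => ⟨?_, ?_⟩
  · rintro ⟨l, hl⟩
    obtain ⟨-, w, t, rfl, hp, hD⟩ := hG.isThread_iff.1 hl
    exact ⟨w, ⟨hD.ht_pos, hp⟩, hG.isThreadRoot_of_isDownPath hD⟩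
  · rintro ⟨w, hw, hT⟩
    obtain ⟨t, hD⟩ := hG.exists_isDownPath hT
    exact ⟨w :: t, hG.isThread_iff.2 ⟨by omega, w, t, rfl, hw.2, hD⟩⟩

lemma three_le_deg_of_children (hG : IsUnicyclic G) {v w w' : V} (hw : w ∈ children G v)
    (hw' : w' ∈ children G v) (hne : w ≠ w') : 3 ≤ deg G v := by
  have h2 : 1 < (children G v).ncard := (Set.one_lt_ncard (Set.toFinite _)).2 ⟨w, hw, w', hw', hne⟩
  rcases Nat.eq_zero_or_pos (ht G v) with h | h
  · have := hG.deg_of_ht_eq_zero h; omega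
  · have := hG.deg_of_ht_pos h; omega

/-- This is the form used from here on: no two sibling threads are both missed by `S`. The degree
bound disappears because a vertex with two children has degree at least 3. -/
lemma isBranchResolving_iff (hG : IsUnicyclic G) {S : Set V} :
    IsBranchResolving G S ↔ ∀ w w', IsThreadRoot G w → IsThreadRoot G w' → par G w = par G w' →
      (∀ s ∈ S, ¬ IsDesc G w s) → (∀ s ∈ S, ¬ IsDesc G w' s) → w = w' := by
  have key : ∀ v, (threads G v).ncard - 1 ≤ {l | l ∈ threads G v ∧ ∃ x ∈ l, x ∈ S}.ncard ↔
      ∀ l ∈ threads G v, (∀ x ∈ l, x ∉ S) → ∀ l' ∈ threads G v, (∀ x ∈ l', x ∉ S) → l = l' := by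
    intro v
    have hfin := hG.threads_finite v
    have h1 := Set.ncard_inter_add_ncard_sdiff_eq_ncard (threads G v) {l | ∃ x ∈ l, x ∈ S} hfin
    have h2 : {l | l ∈ threads G v ∧ ∃ x ∈ l, x ∈ S} = threads G v ∩ {l | ∃ x ∈ l, x ∈ S} := rfl
    rw [h2, ← h1]
    have h3 : ∀ a b : ℕ, a + b - 1 ≤ a ↔ b ≤ 1 := by omega
    rw [h3, Set.ncard_le_one (hfin.subset Set.sdiff_subset)]
    constructor
    · intro h l hl hl' l2 hl2 hl2'
      exact h l ⟨hl, fun ⟨x, hx, hxS⟩ => hl' x hx hxS⟩ l2 ⟨hl2, fun ⟨x, hx, hxS⟩ => hl2' x hx hxS⟩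
    · rintro h l ⟨hl, hl'⟩ l2 ⟨hl2, hl2'⟩
      exact h l hl (fun x hx hxS => hl' ⟨x, hx, hxS⟩) l2 hl2 (fun x hx hxS => hl2' ⟨x, hx, hxS⟩)
  constructor
  · intro h w w' hw hw' hp hS hS'
    by_contra hne
    have h3 := hG.three_le_deg_of_children (v := par G w) ⟨hw.1, rfl⟩ ⟨hw'.1, hp.symm⟩ hne
    obtain ⟨t, hD⟩ := hG.exists_isDownPath hw
    obtain ⟨t', hD'⟩ := hG.exists_isDownPath hw'
    have := (key _).1 (h _ h3) (w :: t) (hG.isThread_iff.2 ⟨h3, w, t, rfl, rfl, hD⟩)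
      (fun x hx hxS => hS x hxS ((hG.mem_isDownPath hD).1 hx))
      (w' :: t') (hG.isThread_iff.2 ⟨h3, w', t', rfl, hp.symm, hD'⟩)
      (fun x hx hxS => hS' x hxS ((hG.mem_isDownPath hD').1 hx))
    exact hne (List.cons.inj this).1
  · intro h v h3
    rw [key]
    intro l hl hlS l' hl' hlS'
    obtain ⟨-, w, t, rfl, hp, hD⟩ := hG.isThread_iff.1 hl
    obtain ⟨-, w', t', rfl, hp', hD'⟩ := hG.isThread_iff.1 hl'
    have := h w w' (hG.isThreadRoot_of_isDownPath hD) (hG.isThreadRoot_of_isDownPath hD')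
      (hp.trans hp'.symm) (fun s hs hd => hlS s ((hG.mem_isDownPath hD).2 hd) hs)
      (fun s hs hd => hlS' s ((hG.mem_isDownPath hD').2 hd) hs)
    subst this
    rw [hG.isDownPath_unique hD hD']

end IsUnicyclic

end

/-! ### Branch-resolving sets and pairs in a common tree -/

section

lemma branchNumber_le {R : Set V} (hR : IsBranchResolving G R) : branchNumber G ≤ R.ncard :=
  Nat.sInf_le ⟨R, hR, rfl⟩

namespace IsUnicyclic

/-- Climb from both vertices in step until the parents coincide. -/
lemma exists_meet (hG : IsUnicyclic G) {x y : V} (hr : rt G x = rt G y) (hh : ht G x = ht G y)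
    (hne : x ≠ y) : ∃ v, ∃ w ∈ children G v, ∃ w' ∈ children G v,
      w ≠ w' ∧ IsDesc G w x ∧ IsDesc G w' y := by
  induction hn : ht G x generalizing x y with
  | zero =>
    rw [rt_of_ht_eq_zero hn, rt_of_ht_eq_zero (hh ▸ hn)] at hr
    exact absurd hr hne
  | succ n ih =>
    by_cases hp : par G x = par G y
    · exact ⟨par G x, x, ⟨by omega, rfl⟩, y, ⟨by omega, hp.symm⟩, hne, .refl _, .refl _⟩
    · obtain ⟨v, w, hw, w', hw', hne', h1, h2⟩ := ih (by rw [hG.rt_par, hG.rt_par, hr])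
        (by rw [hG.ht_par, hG.ht_par, hh]) hp (by rw [hG.ht_par]; omega)
      exact ⟨v, w, hw, w', hw', hne', h1.trans (isDesc_par _), h2.trans (isDesc_par _)⟩

variable [Finite V]

/-! ### Trees and active vertices -/

lemma mem_treeVerts (hG : IsUnicyclic G) {c w : V} (hc : c ∈ cycleVerts G) :
    w ∈ treeVerts G c ↔ rt G w = c := by
  constructor
  · rintro ⟨p⟩
    rw [← rt_of_ht_eq_zero (hG.ht_eq_zero.2 hc)]
    clear hc
    induction p with
    | nil => rfl
    | cons h p ih =>
      rw [ih]
      rw [SimpleGraph.deleteEdges_adj] at h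
      rcases hG.adj_iff.1 h.1 with h' | ⟨-, rfl⟩ | ⟨-, rfl⟩
      · exact absurd h' h.2
      · rw [hG.rt_par]
      · rw [hG.rt_par]
  · rintro rfl
    induction hn : ht G w generalizing w with
    | zero => rw [rt_of_ht_eq_zero hn]; exact .refl _
    | succ n ih =>
      have h0 : 0 < ht G w := by omega
      have := ih (w := par G w) (hG.rt_mem _) (by rw [hG.ht_par]; omega)
      rw [hG.rt_par] at this
      refine SimpleGraph.Reachable.trans this (SimpleGraph.Adj.reachable ?_)
      rw [SimpleGraph.deleteEdges_adj]
      refine ⟨(hG.par_spec h0).1.symm, fun he => ?_⟩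
      have := hG.ht_of_mem_cycleEdges he
      omega

lemma mem_active (hG : IsUnicyclic G) {S : Set V} {c : V} :
    c ∈ active G S ↔ ∃ s ∈ S, rt G s = c := by
  constructor
  · rintro ⟨hc, s, hs, h⟩
    exact ⟨s, hs, (hG.mem_treeVerts hc).1 h⟩
  · rintro ⟨s, hs, rfl⟩
    exact ⟨hG.rt_mem s, s, hs, (hG.mem_treeVerts (hG.rt_mem s)).2 rfl⟩

/-! ### Branch-resolving sets -/

/-- Work from the deepest vertices upwards: a vertex of the unhit subtree with two children would
carry two sibling threads, both missed by `R`. -/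
lemma isThreadRoot_of_unhit (hG : IsUnicyclic G) {R : Set V} (hR : IsBranchResolving G R) {w : V}
    (h0 : 0 < ht G w) (hw : ∀ s ∈ R, ¬ IsDesc G w s) : IsThreadRoot G w := by
  refine ⟨h0, ?_⟩
  obtain ⟨N, hN⟩ := exists_ht_bound (G := G)
  have key : ∀ n z, N - ht G z ≤ n → IsDesc G w z → deg G z ≤ 2 := by
    intro n
    induction n with
    | zero =>
      intro z hz hwz
      have h1 := hG.ht_le_of_isDesc hwz
      have h2 := hG.deg_of_ht_pos (v := z) (by omega)
      have h3 : children G z = ∅ := by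
        rw [Set.eq_empty_iff_forall_notMem]
        intro x hx
        have := hG.ht_of_mem_children hx
        have := hN x
        omega
      rw [h3, Set.ncard_empty] at h2
      omega
    | succ n ih =>
      intro z hz hwz
      have h1 := hG.ht_le_of_isDesc hwz
      have h2 := hG.deg_of_ht_pos (v := z) (by omega)
      by_contra hcon
      obtain ⟨x, hx, y, hy, hne⟩ := (Set.one_lt_ncard (Set.toFinite _)).1
        (show 1 < (children G z).ncard by omega)
      have hT : ∀ x ∈ children G z, IsThreadRoot G x ∧ ∀ s ∈ R, ¬ IsDesc G x s := by
        intro x hx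
        have h3 := hG.ht_of_mem_children hx
        have h4 := hN x
        have h5 := hwz.trans (isDesc_of_mem_children hx)
        refine ⟨⟨hx.1, fun u hu => ih u ?_ (h5.trans hu)⟩, fun s hs hd => hw s hs (h5.trans hd)⟩
        have := hG.ht_le_of_isDesc hu
        omega
      exact hne (hG.isBranchResolving_iff.1 hR x y (hT x hx).1 (hT y hy).1
        (hx.2.trans hy.2.symm) (hT x hx).2 (hT y hy).2)
  exact fun z hz => key _ z le_rfl hz

lemma isBranchResolving_mono (hG : IsUnicyclic G) {R R' : Set V} (hR : IsBranchResolving G R)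
    (h : R ⊆ R') : IsBranchResolving G R' := by
  rw [hG.isBranchResolving_iff] at hR ⊢
  exact fun w w' hw hw' hp h1 h2 => hR w w' hw hw' hp (fun s hs => h1 s (h hs))
    (fun s hs => h2 s (h hs))

lemma exists_isDesc_of_children (hG : IsUnicyclic G) {R : Set V} (hR : IsBranchResolving G R)
    {v w w' : V} (hw : w ∈ children G v) (hw' : w' ∈ children G v) (hne : w ≠ w') :
    ∃ s ∈ R, IsDesc G v s := by
  by_contra! hcon
  have h : ∀ w ∈ children G v, ∀ s ∈ R, ¬ IsDesc G w s :=
    fun w hw s hs hd => hcon s hs ((isDesc_of_mem_children hw).trans hd)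
  exact hne (hG.isBranchResolving_iff.1 hR w w' (hG.isThreadRoot_of_unhit hR hw.1 (h w hw))
    (hG.isThreadRoot_of_unhit hR hw'.1 (h w' hw')) (hw.2.trans hw'.2.symm) (h w hw) (h w' hw'))

lemma isBranching_iff (hG : IsUnicyclic G) {v : V} :
    IsBranching G v ↔ 1 < (children G v).ncard := by
  rw [IsBranching, ← hG.ht_eq_zero]
  rcases Nat.eq_zero_or_pos (ht G v) with h | h
  · have := hG.deg_of_ht_eq_zero h; omega
  · have := hG.deg_of_ht_pos h; omega

lemma exists_rt_eq_of_isBranching (hG : IsUnicyclic G) {R : Set V} (hR : IsBranchResolving G R)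
    {v : V} (hv : IsBranching G v) : ∃ s ∈ R, rt G s = rt G v := by
  obtain ⟨x, hx, y, hy, hne⟩ := (Set.one_lt_ncard (Set.toFinite _)).1 (hG.isBranching_iff.1 hv)
  obtain ⟨s, hs, hd⟩ := hG.exists_isDesc_of_children hR hx hy hne
  exact ⟨s, hs, (hG.rt_eq_of_isDesc hd).symm⟩

/-- An unhit child starts a thread, so a vertex that is not bad has degree at most 3 and this is its
only child. The landmark in its tree, being off the cycle, then lies below that child. -/
lemma exists_isDesc_of_not_isBad (hG : IsUnicyclic G) {R : Set V} (hR : IsBranchResolving G R)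
    {v w s : V} (hv : v ∈ cycleVerts G) (hbad : ¬ IsBad G v) (hw : w ∈ children G v) (hs : s ∈ R)
    (hsv : rt G s = v) (hs0 : 0 < ht G s ∨ children G v = ∅) : ∃ s ∈ R, IsDesc G w s := by
  by_contra! hcon
  have hT := hG.isThreadRoot_of_unhit hR hw.1 hcon
  have h0 := hG.ht_eq_zero.2 hv
  have hd := hG.deg_of_ht_eq_zero h0
  have h4 : ¬ 4 ≤ deg G v := fun h4 => hbad (hG.isBad_iff.2 ⟨hv, h4, w, hw, hT⟩)
  rcases hs0 with hs0 | hs0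
  · obtain ⟨w', hw', hws⟩ := hG.exists_child (v := v) (z := s) (hsv ▸ isDesc_rt s) (by omega)
    have := (Set.ncard_le_one (Set.toFinite _)).1
      (show (children G v).ncard ≤ 1 by omega) w hw w' hw'
    exact hcon s hs (this ▸ hws)
  · rw [hs0] at hw
    exact hw

/-! ### Minimum branch-resolving sets -/

/-- Removing `s` creates two sibling threads without landmark, of which `R` itself hits at least
one; so `s` was the only landmark on one of them and the other was already missed. -/
lemma exists_siblings_of_min (hG : IsUnicyclic G) {R : Set V} (hR : IsBranchResolving G R)
    (hmin : R.ncard = branchNumber G) {s : V} (hs : s ∈ R) :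
    ∃ w w', IsThreadRoot G w ∧ IsThreadRoot G w' ∧ par G w = par G w' ∧ w ≠ w' ∧ IsDesc G w s ∧
      ∀ r ∈ R, ¬ IsDesc G w' r := by
  have h1 : ¬ IsBranchResolving G (R \ {s}) := by
    intro h
    have h2 := branchNumber_le h
    have h3 := Set.ncard_sdiff_singleton_lt_of_mem hs (Set.toFinite R)
    omega
  rw [hG.isBranchResolving_iff] at h1
  push Not at h1
  obtain ⟨w, w', hw, hw', hp, hS, hS', hne⟩ := h1
  have hcw : w ∈ children G (par G w) := ⟨hw.1, rfl⟩
  have hcw' : w' ∈ children G (par G w) := ⟨hw'.1, hp.symm⟩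
  by_cases hws : IsDesc G w s
  · refine ⟨w, w', hw, hw', hp, hne, hws, fun r hr hd => ?_⟩
    by_cases hrs : r = s
    · subst hrs
      exact hne (hG.eq_of_mem_children hcw hcw' hws hd)
    · exact hS' r ⟨hr, hrs⟩ hd
  · have hwR : ∀ r ∈ R, ¬ IsDesc G w r := by
      intro r hr hd
      by_cases hrs : r = s
      · exact hws (hrs ▸ hd)
      · exact hS r ⟨hr, hrs⟩ hd
    refine ⟨w', w, hw', hw, hp.symm, hne.symm, ?_, hwR⟩
    by_contra hws'
    refine hne (hG.isBranchResolving_iff.1 hR w w' hw hw' hp hwR fun r hr hd => ?_)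
    by_cases hrs : r = s
    · exact hws' (hrs ▸ hd)
    · exact hS' r ⟨hr, hrs⟩ hd

/-- A landmark of a minimum set sits on one of two sibling threads, and every branch-resolving set
needs a vertex on such a pair. -/
lemma exists_rt_eq_of_min (hG : IsUnicyclic G) {R R' : Set V} (hR : IsBranchResolving G R)
    (hmin : R.ncard = branchNumber G) (hR' : IsBranchResolving G R') {s : V} (hs : s ∈ R) :
    ∃ s' ∈ R', rt G s' = rt G s := by
  obtain ⟨w, w', hw, hw', hp, hne, hd, -⟩ := hG.exists_siblings_of_min hR hmin hs
  obtain ⟨s', hs', hd'⟩ := hG.exists_isDesc_of_children hR' (v := par G w) ⟨hw.1, rfl⟩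
    ⟨hw'.1, hp.symm⟩ hne
  refine ⟨s', hs', ?_⟩
  rw [← hG.rt_eq_of_isDesc hd', hG.rt_par, hG.rt_eq_of_isDesc hd]

lemma active_eq_of_min (hG : IsUnicyclic G) {R R' : Set V} (hR : IsBranchResolving G R)
    (hmin : R.ncard = branchNumber G) (hR' : IsBranchResolving G R')
    (hmin' : R'.ncard = branchNumber G) : active G R = active G R' := by
  ext c
  rw [hG.mem_active, hG.mem_active]
  constructor
  · rintro ⟨s, hs, rfl⟩
    exact hG.exists_rt_eq_of_min hR hmin hR' hs
  · rintro ⟨s, hs, rfl⟩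
    exact hG.exists_rt_eq_of_min hR' hmin' hR hs

lemma exists_unhit_of_isBad (hG : IsUnicyclic G) {R : Set V} (hR : IsBranchResolving G R)
    (hmin : R.ncard = branchNumber G) {v : V} (hv : IsBad G v) :
    ∃ w ∈ children G v, ∀ r ∈ R, ¬ IsDesc G w r := by
  obtain ⟨-, h4, w, hw, hT⟩ := hG.isBad_iff.1 hv
  by_contra! hcon
  obtain ⟨s, hs, hws⟩ := hcon w hw
  obtain ⟨w₁, w₂, hw₁, hw₂, hp, hne, hd, hun⟩ := hG.exists_siblings_of_min hR hmin hs
  have h3 := hG.three_le_deg_of_children (v := par G w₁) ⟨hw₁.1, rfl⟩ ⟨hw₂.1, hp.symm⟩ hne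
  -- Both vertices are ancestors of `s` and start threads. If they differed, the upper one would
  -- have the parent of the lower one, a vertex of degree at least 3, in its thread.
  have heq : w₁ = w := by
    rcases le_total (ht G w₁) (ht G w) with h | h
    · rcases (hG.isDesc_of_ht_le hd hws h).eq_or with h' | h'
      · exact h'.symm
      · have := hw₁.2 _ h'
        rw [hw.2] at this
        omega
    · rcases (hG.isDesc_of_ht_le hws hd h).eq_or with h' | h'
      · exact h'
      · have := hT.2 _ h'
        omega
  subst heq
  obtain ⟨r, hr, hd'⟩ := hcon w₂ ⟨hw₂.1, hp.symm.trans hw.2⟩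
  exact hun r hr hd'

/-! ### Metric generators -/

lemma isBranchResolving_of_isMetricGenerator (hG : IsUnicyclic G) {R : Set V}
    (hR : IsMetricGenerator G R) : IsBranchResolving G R := by
  rw [hG.isBranchResolving_iff]
  intro w w' hw hw' hp h h'
  by_contra hne
  obtain ⟨s, hs, hd⟩ := hR w w' hne
  apply hd
  rw [hG.dist_eq_dist_par_add_one hw.1 (h s hs), hG.dist_eq_dist_par_add_one hw'.1 (h' s hs), hp]

lemma dist_lt_of_children (hG : IsUnicyclic G) {v w w' x y s : V} (hw : w ∈ children G v)
    (hw' : w' ∈ children G v) (hne : w ≠ w') (hx : IsDesc G w x) (hy : IsDesc G w' y)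
    (hh : ht G x = ht G y) (hs : IsDesc G w s) : G.dist s x < G.dist s y := by
  have h1 := hG.dist_le_of_common hs hx
  have h2 := hG.dist_of_not_isDesc hw'.1 hy
    (fun h => hne (hG.eq_of_mem_children hw hw' hs h))
  have h3 := hG.dist_of_isDesc ((isDesc_of_mem_children hw).trans hs)
  have h4 := hG.ht_of_mem_children hw
  have h5 := hG.ht_of_mem_children hw'
  have h6 := hG.ht_le_of_isDesc hs
  have h7 := hG.ht_le_of_isDesc hx
  rw [hw'.2] at h2
  omega

/-- The outside landmark `s` separates vertices of different heights. At equal heights the two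
vertices lie below distinct siblings; a landmark below either sibling is nearer to its own side, and
if there were none both siblings would start missed threads. -/
lemma exists_dist_ne_of_rt_eq (hG : IsUnicyclic G) {R : Set V} (hR : IsBranchResolving G R)
    {x y s : V} (hr : rt G x = rt G y) (hne : x ≠ y) (hs : s ∈ R) (hsx : rt G s ≠ rt G x) :
    ∃ s ∈ R, G.dist s x ≠ G.dist s y := by
  by_contra! hcon
  have hh : ht G x = ht G y := by
    have h := hcon s hs
    rw [hG.dist_of_rt_ne hsx, hG.dist_of_rt_ne (show rt G s ≠ rt G y from hr ▸ hsx), hr] at h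
    omega
  obtain ⟨v, w, hw, w', hw', hne', h1, h2⟩ := hG.exists_meet hr hh hne
  have hun : ∀ r ∈ R, ¬ IsDesc G w r := fun r hrR hd =>
    (hG.dist_lt_of_children hw hw' hne' h1 h2 hh hd).ne (hcon r hrR)
  have hun' : ∀ r ∈ R, ¬ IsDesc G w' r := fun r hrR hd =>
    (hG.dist_lt_of_children hw' hw hne'.symm h2 h1 hh.symm hd).ne (hcon r hrR).symm
  exact hne' (hG.isBranchResolving_iff.1 hR w w' (hG.isThreadRoot_of_unhit hR hw.1 hun)
    (hG.isThreadRoot_of_unhit hR hw'.1 hun') (hw.2.trans hw'.2.symm) hun hun')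

end IsUnicyclic

end

section

/-! ### Arithmetic of distances on a cycle -/

/-- The distance between the vertices `i, j < ℓ` of a cycle of length `ℓ`. -/
def cycDist (ℓ i j : ℕ) : ℕ := min (i - j + (j - i)) (ℓ - (i - j + (j - i)))

lemma cycDist_comm (ℓ i j : ℕ) : cycDist ℓ i j = cycDist ℓ j i := by unfold cycDist; omega

lemma cycDist_cases {ℓ i j : ℕ} (h : i ≤ j) (hl : j ≤ ℓ + i) :
    (2 * j ≤ ℓ + 2 * i ∧ cycDist ℓ i j + i = j) ∨
      (ℓ + 2 * i ≤ 2 * j ∧ cycDist ℓ i j + j = ℓ + i) := by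
  unfold cycDist; omega

lemma cycDist_cases' {ℓ i j : ℕ} (h : j ≤ i) (hl : i ≤ ℓ + j) :
    (2 * i ≤ ℓ + 2 * j ∧ cycDist ℓ i j + j = i) ∨
      (ℓ + 2 * j ≤ 2 * i ∧ cycDist ℓ i j + i = ℓ + j) := by
  rw [cycDist_comm]; exact cycDist_cases h hl

/-- The constraints that hold if a vertex of the tree at position `r` does not resolve two vertices
of heights `h`, `h'` in the trees at positions `p`, `q`. -/
def Unresolved (ℓ p q h h' r : ℕ) : Prop :=
  (r ≠ p ∧ r ≠ q ∧ cycDist ℓ r p + h = cycDist ℓ r q + h') ∨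
  (r = p ∧ cycDist ℓ p q + h' ≤ h) ∨ (r = q ∧ cycDist ℓ p q + h ≤ h')

namespace Unresolved

variable {ℓ p q h h' : ℕ}

lemma symm {r : ℕ} (u : Unresolved ℓ p q h h' r) : Unresolved ℓ q p h' h r := by
  rcases u with ⟨a, b, c⟩ | ⟨a, b⟩ | ⟨a, b⟩
  · exact .inl ⟨b, a, c.symm⟩
  · exact .inr (.inr ⟨a, by rwa [cycDist_comm]⟩)
  · exact .inr (.inl ⟨a, by rwa [cycDist_comm]⟩)

/-- The landmark at `r` forces `h - h' ≥ q - p`, the one at `r'` forces `h - h' ≤ p - q`. -/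
lemma false_of_same_arc {r r' : ℕ} (h1 : r ≤ p) (h2 : p < q) (h3 : q ≤ r')
    (hs : 2 * r' ≤ ℓ + 2 * r) (u : Unresolved ℓ p q h h' r) (u' : Unresolved ℓ p q h h' r') :
    False := by
  have e1 := (cycDist_cases (ℓ := ℓ) h1 (by omega)).resolve_right (by omega)
  have e2 := cycDist_cases (ℓ := ℓ) (h1.trans h2.le) (by omega)
  have e3 := cycDist_cases' (ℓ := ℓ) (h2.le.trans h3) (by omega)
  have e4 := (cycDist_cases' (ℓ := ℓ) h3 (by omega))
  have e5 := cycDist_cases (ℓ := ℓ) h2.le (by omega)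
  replace e2 : cycDist ℓ r q + r = q := by omega
  replace e3 : cycDist ℓ r' p + p = r' := by omega
  replace e4 : cycDist ℓ r' q + q = r' := by omega
  replace e5 : cycDist ℓ p q + p = q := by omega
  rcases u with u | u | u <;> rcases u' with u' | u' | u' <;> omega

/-- The landmarks would give d(r,p) + d(r',q) ≥ d(r,q) + d(r',p), but the crossed sum is always
strictly larger. The index `i` only bounds the arcs; no landmark at `i` is used. -/
lemma false_of_adjacent_arcs {r i r' : ℕ} (h1 : r ≤ p) (h2 : p < i) (h3 : i < q) (h4 : q ≤ r')
    (hs : 2 * i ≤ ℓ + 2 * r) (hs' : 2 * r' ≤ ℓ + 2 * i) (hl : r' < ℓ + r)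
    (u : Unresolved ℓ p q h h' r) (u' : Unresolved ℓ p q h h' r') : False := by
  have e1 := (cycDist_cases (ℓ := ℓ) h1 (by omega)).resolve_right (by omega)
  have e4 := (cycDist_cases' (ℓ := ℓ) h4 (by omega)).resolve_right (by omega)
  rcases cycDist_cases (ℓ := ℓ) (show r ≤ q by omega) (by omega) with e2 | e2 <;>
  rcases cycDist_cases' (ℓ := ℓ) (show p ≤ r' by omega) (by omega) with e3 | e3 <;>
  rcases cycDist_cases (ℓ := ℓ) (show p ≤ q by omega) (by omega) with e5 | e5 <;>
  rcases u with u | u | u <;> rcases u' with u' | u' | u' <;> omega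

/-- This unrolls the cycle, so that the arc that ends at index 0 can be treated as an interval. -/
lemma add_left {r : ℕ} (hp : r < p) (hpl : p < ℓ + r) (hq : r < q)
    (hql : q < ℓ + r) (u : Unresolved ℓ p q h h' r) : Unresolved ℓ p q h h' (ℓ + r) := by
  have e1 : cycDist ℓ r p = cycDist ℓ (ℓ + r) p := by unfold cycDist; omega
  have e2 : cycDist ℓ r q = cycDist ℓ (ℓ + r) q := by unfold cycDist; omega
  unfold Unresolved at *
  rw [← e1, ← e2]
  omega

/-- The three landmarks cut the cycle into arcs of length at most ℓ/2, so `p` and `q` share an arc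
or lie on two arcs with a common end. -/
lemma false_of_triple {i j : ℕ} (h1 : 0 < i) (h2 : i < j) (h3 : j < ℓ) (hpq : p ≠ q) (hp : p < ℓ)
    (hq : q < ℓ) (hi : 2 * i ≤ ℓ) (hij : 2 * j ≤ ℓ + 2 * i) (hj : ℓ ≤ 2 * j)
    (u0 : Unresolved ℓ p q h h' 0) (ui : Unresolved ℓ p q h h' i)
    (uj : Unresolved ℓ p q h h' j) : False := by
  wlog hlt : p < q generalizing p q h h'
  · exact this hpq.symm hq hp u0.symm ui.symm uj.symm (by omega)
  rcases le_or_gt q i with hqi | hqi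
  · exact false_of_same_arc (Nat.zero_le p) hlt hqi (by omega) u0 ui
  rcases le_or_gt i p with hpi | hpi
  · rcases le_or_gt q j with hqj | hqj
    · exact false_of_same_arc hpi hlt hqj (by omega) ui uj
    have ul := u0.add_left (by omega) (by omega) (by omega) (by omega)
    rcases le_or_gt j p with hpj | hpj
    · exact false_of_same_arc hpj hlt (by omega) (by omega) uj ul
    · exact false_of_adjacent_arcs hpi hpj hqj (by omega) (by omega) (by omega) (by omega) ui ul
  · rcases le_or_gt q j with hqj | hqj
    · exact false_of_adjacent_arcs (Nat.zero_le p) hpi hqi hqj (by omega) (by omega) (by omega) u0 uj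
    · have e1 : cycDist ℓ (ℓ + i) (ℓ + p) = cycDist ℓ i p := by unfold cycDist; omega
      have e2 : cycDist ℓ j (ℓ + p) = cycDist ℓ j p := by unfold cycDist; omega
      have e3 : cycDist ℓ (ℓ + i) q = cycDist ℓ i q := by unfold cycDist; omega
      have e4 : cycDist ℓ q (ℓ + p) = cycDist ℓ p q := by unfold cycDist; omega
      have uj' : Unresolved ℓ q (ℓ + p) h' h j := by
        unfold Unresolved at *
        rw [e2, e4]
        omega
      have ui' : Unresolved ℓ q (ℓ + p) h' h (ℓ + i) := by
        unfold Unresolved at *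
        rw [e1, e4, e3]
        omega
      -- The separating index is `ℓ`, which must be strictly below `ℓ + p`. For `p = 0` the pair
      -- lies on the closed arc from `j` to `ℓ` instead.
      rcases Nat.eq_zero_or_pos p with rfl | hp0
      · refine false_of_same_arc hqj.le (by omega) (le_refl _) (by omega) uj' ?_
        have e5 : cycDist ℓ q (ℓ + 0) = cycDist ℓ 0 q := by unfold cycDist; omega
        unfold Unresolved at *
        rw [e5]
        omega
      · exact false_of_adjacent_arcs hqj.le hq (by omega) (show ℓ + p ≤ ℓ + i by omega)
          (by omega) (by omega) (by omega) uj' ui'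

/-- An unresolved pair away from the ends has equal values of d(0,·) - d(j,·) + 0 if both indices
lie beyond `j`, where this difference is injective except on two plateaus. A plateau pair needs
positive height at the index nearer its end, which `htp` and `htq` forbid. A pair split by the ends
is critical only for even ℓ. -/
lemma false_of_off_ends {i j H : ℕ} (hj : 1 ≤ j) (hjl : 2 * j < ℓ) (hH : ℓ = 2 * H + 2 ∨
    ℓ = 2 * H + 3) (hpq : p < q) (hq : q < ℓ) (hp0 : p ≠ 0) (hpj : p ≠ j) (hqj : q ≠ j)
    (htp : (j < p ∧ p ≤ H) ∨ ℓ + j ≤ p + H → h = 0)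
    (htq : (j < q ∧ q ≤ H) ∨ ℓ + j ≤ q + H → h' = 0)
    (hsh : ℓ = 2 * H + 2 → (0 < i ∧ i < j ∧ Unresolved ℓ p q h h' i) ∨
      (p < j → h + j ≤ H))
    (u0 : Unresolved ℓ p q h h' 0) (uj : Unresolved ℓ p q h h' j) : False := by
  have u0' : cycDist ℓ 0 p + h = cycDist ℓ 0 q + h' := by
    rcases u0 with u | u | u <;> omega
  have uj' : cycDist ℓ j p + h = cycDist ℓ j q + h' := by
    rcases uj with u | u | u <;> omega
  rcases le_or_gt q j with hqj' | hqj'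
  · exact false_of_same_arc (Nat.zero_le p) hpq hqj' (by omega) u0 uj
  rcases le_or_gt j p with hpj' | hpj'
  · rcases cycDist_cases (ℓ := ℓ) hqj'.le (by omega) with e4 | e4 <;>
    rcases cycDist_cases (ℓ := ℓ) hpj' (by omega) with e3 | e3 <;>
    rcases cycDist_cases (ℓ := ℓ) (Nat.zero_le p) (by omega) with e1 | e1 <;>
    rcases cycDist_cases (ℓ := ℓ) (Nat.zero_le q) (by omega) with e2 | e2 <;> omega
  · have e1 := (cycDist_cases (ℓ := ℓ) (Nat.zero_le p) (by omega)).resolve_right (by omega)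
    have e3 := (cycDist_cases' (ℓ := ℓ) hpj'.le (by omega)).resolve_right (by omega)
    rcases cycDist_cases (ℓ := ℓ) hqj'.le (by omega) with e4 | e4 <;>
    rcases cycDist_cases (ℓ := ℓ) (Nat.zero_le q) (by omega) with e2 | e2
    · omega
    -- Here the geodesics to `q` leave 0 and `j` in opposite directions. Equating gives `2(p + q -
    -- j) = ℓ`, impossible for odd ℓ; for even ℓ it yields `h = h' + H + 1 - j`, against the height
    -- bound or the landmark at `i`.
    · rcases hH with hH | hH
      · rcases hsh hH with ⟨h1, h2, ui⟩ | hsh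
        · have e6 := cycDist_cases (ℓ := ℓ) (show i ≤ q by omega) (by omega)
          rcases le_total i p with hip | hip
          · have e7 := (cycDist_cases (ℓ := ℓ) hip (by omega)).resolve_right (by omega)
            have e5 := cycDist_cases (ℓ := ℓ) hpq.le (by omega)
            rcases e6 with e6 | e6 <;> rcases e5 with e5 | e5 <;>
            rcases ui with ui | ui | ui <;> omega
          · have e7 := (cycDist_cases' (ℓ := ℓ) hip (by omega)).resolve_right (by omega)
            have e5 := cycDist_cases (ℓ := ℓ) hpq.le (by omega)
            rcases e6 with e6 | e6 <;> rcases e5 with e5 | e5 <;>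
            rcases ui with ui | ui | ui <;> omega
        · omega
      · omega
    · omega
    · omega

/-- The landmark at the end `p` bounds `h` below, the one at the other end bounds it above. Equality
means that a geodesic from the other end to `q` continues through `p`, so `j + 1 ≤ ℓ/2`. -/
lemma ht_eq_of_end {j : ℕ} (hj : 1 ≤ j) (hjl : 2 * j < ℓ) (hpq : p ≠ q) (hq : q < ℓ)
    (hp : 0 = p ∨ j = p) (u0 : Unresolved ℓ p q h h' 0) (uj : Unresolved ℓ p q h h' j) :
    h = cycDist ℓ p q + h' ∧ 2 * j + 1 < ℓ := by
  have e1 := (cycDist_cases (ℓ := ℓ) (Nat.zero_le j) (by omega)).resolve_right (by omega)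
  have e0 := (cycDist_cases' (ℓ := ℓ) (Nat.zero_le j) (by omega)).resolve_right (by omega)
  rcases cycDist_cases (ℓ := ℓ) (Nat.zero_le q) (by omega) with e2 | e2 <;>
  rcases hp with rfl | rfl
  all_goals
    rcases le_total q j with h1 | h1
    · rcases cycDist_cases' (ℓ := ℓ) h1 (by omega) with e3 | e3 <;>
      rcases u0 with u | u | u <;> rcases uj with u' | u' | u' <;> omega
    · rcases cycDist_cases (ℓ := ℓ) h1 (by omega) with e3 | e3 <;>
      rcases u0 with u | u | u <;> rcases uj with u' | u' | u' <;> omega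

end Unresolved

end

section

/-! ### Positions with respect to a labelling -/

/-- The index, in the labelling `a` of the cycle, of the tree that contains `v`. -/
noncomputable def pos (G : SimpleGraph V) {ℓ : ℕ} (a : ZMod ℓ → V) (v : V) : ℕ :=
  sInf {i : ℕ | i < ℓ ∧ a (i : ZMod ℓ) = rt G v}

variable {ℓ : ℕ} {a : ZMod ℓ → V}

lemma IsCycleLabelling.eq_of_natCast (ha : IsCycleLabelling G a) {i j : ℕ} (hi : i < ℓ)
    (hj : j < ℓ) (h : a (i : ZMod ℓ) = a (j : ZMod ℓ)) : i = j := by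
  have h1 := ha.2.1 h
  rw [ZMod.natCast_eq_natCast_iff', Nat.mod_eq_of_lt hi, Nat.mod_eq_of_lt hj] at h1
  exact h1

/-- A labelling of the whole cycle of a unicyclic graph on a finite vertex set. -/
structure Labelled (G : SimpleGraph V) {ℓ : ℕ} (a : ZMod ℓ → V) : Prop where
  finite : Finite V
  unicyclic : IsUnicyclic G
  labelling : IsCycleLabelling G a
  length : cycleLength G = ℓ

namespace Labelled

lemma three_le (H : Labelled G a) : 3 ≤ ℓ := H.labelling.1

lemma ht_label (H : Labelled G a) (i : ZMod ℓ) : ht G (a i) = 0 := by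
  have := H.finite
  rw [H.unicyclic.ht_eq_zero, H.labelling.cycleVerts_eq H.length]
  exact ⟨i, rfl⟩

lemma rt_label (H : Labelled G a) (i : ZMod ℓ) : rt G (a i) = a i :=
  rt_of_ht_eq_zero (H.ht_label i)

lemma pos_spec (H : Labelled G a) (v : V) :
    pos G a v < ℓ ∧ a (pos G a v : ZMod ℓ) = rt G v := by
  have := H.finite
  have := H.labelling.neZero
  have h := H.unicyclic.rt_mem v
  rw [H.labelling.cycleVerts_eq H.length] at h
  obtain ⟨i, hi⟩ := h
  exact Nat.sInf_mem (s := {i : ℕ | i < ℓ ∧ a (i : ZMod ℓ) = rt G v})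
    ⟨i.val, i.val_lt, by simpa using hi⟩

lemma pos_lt (H : Labelled G a) (v : V) : pos G a v < ℓ := (H.pos_spec v).1

lemma label_pos (H : Labelled G a) (v : V) : a (pos G a v : ZMod ℓ) = rt G v := (H.pos_spec v).2

lemma pos_eq (H : Labelled G a) {v : V} {i : ℕ} (hi : i < ℓ) (h : rt G v = a (i : ZMod ℓ)) :
    pos G a v = i :=
  H.labelling.eq_of_natCast (H.pos_lt v) hi ((H.label_pos v).trans h)

lemma pos_label (H : Labelled G a) {i : ℕ} (hi : i < ℓ) : pos G a (a (i : ZMod ℓ)) = i :=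
  H.pos_eq hi (H.rt_label _)

lemma pos_eq_pos (H : Labelled G a) {u v : V} : pos G a u = pos G a v ↔ rt G u = rt G v := by
  constructor
  · intro h
    rw [← H.label_pos u, h, H.label_pos]
  · intro h
    exact H.pos_eq (H.pos_lt v) (by rw [h, H.label_pos])

lemma rt_eq_iff (H : Labelled G a) {v : V} {i : ℕ} (hi : i < ℓ) :
    rt G v = a (i : ZMod ℓ) ↔ pos G a v = i := by
  constructor
  · exact H.pos_eq hi
  · rintro rfl
    exact (H.label_pos v).symm

lemma pos_of_mem_children (H : Labelled G a) {v w : V} (h : w ∈ children G v) :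
    pos G a w = pos G a v :=
  H.pos_eq_pos.2 (H.unicyclic.rt_of_mem_children h)

lemma pos_of_isDesc (H : Labelled G a) {v w : V} (h : IsDesc G w v) : pos G a w = pos G a v :=
  H.pos_eq_pos.2 (H.unicyclic.rt_eq_of_isDesc h)

lemma pos_adj (H : Labelled G a) {u v : V} (h : G.Adj u v) :
    pos G a u = pos G a v ∨ pos G a u + 1 = pos G a v ∨ pos G a v + 1 = pos G a u ∨
      (pos G a u = 0 ∧ pos G a v + 1 = ℓ) ∨ (pos G a v = 0 ∧ pos G a u + 1 = ℓ) := by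
  have := H.finite
  have := H.labelling.neZero
  have h3 := H.three_le
  rcases H.unicyclic.adj_iff.1 h with h | ⟨-, h⟩ | ⟨-, h⟩
  · rw [H.labelling.cycleEdges_eq H.length] at h
    obtain ⟨i, hi⟩ := h
    have key : pos G a (a (i + 1)) = pos G a (a i) + 1 ∨
        (pos G a (a (i + 1)) = 0 ∧ pos G a (a i) + 1 = ℓ) := by
      obtain ⟨n, hn, rfl⟩ : ∃ n < ℓ, i = (n : ZMod ℓ) := ⟨i.val, i.val_lt, by simp⟩
      rw [H.pos_label hn]
      rcases Nat.lt_or_ge (n + 1) ℓ with h1 | h1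
      · left
        have := H.pos_label h1
        push_cast at this
        exact this
      · right
        have h4 : n + 1 = ℓ := by omega
        refine ⟨?_, h4⟩
        have h5 : (n : ZMod ℓ) + 1 = ((0 : ℕ) : ZMod ℓ) := by
          have : ((n + 1 : ℕ) : ZMod ℓ) = 0 := by rw [h4]; simp
          push_cast at this ⊢
          exact this
        rw [h5]
        exact H.pos_label (by omega)
    rcases Sym2.eq_iff.1 hi with ⟨rfl, rfl⟩ | ⟨rfl, rfl⟩ <;> omega
  · exact .inl (by rw [H.pos_eq_pos, ← h, H.unicyclic.rt_par])
  · exact .inl (by rw [H.pos_eq_pos, ← h, H.unicyclic.rt_par])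

lemma dist_label_add_le (H : Labelled G a) (i : ZMod ℓ) (n : ℕ) :
    G.dist (a i) (a (i + n)) ≤ n := by
  induction n with
  | zero => simp
  | succ n ih =>
    have h1 := H.unicyclic.1.dist_triangle (u := a i) (v := a (i + n)) (w := a (i + (n + 1 : ℕ)))
    have h2 := H.labelling.2.2 (i + n)
    rw [add_assoc] at h2
    push_cast at h1 ⊢
    rw [SimpleGraph.dist_eq_one_iff_adj.2 h2] at h1
    omega

/-- Walking either way gives the upper bound; for the lower bound, projecting vertices to their
roots makes `cycDist ℓ i` a potential on the whole graph. -/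
lemma dist_label (H : Labelled G a) {i j : ℕ} (hi : i < ℓ) (hj : j < ℓ) :
    G.dist (a (i : ZMod ℓ)) (a (j : ZMod ℓ)) = cycDist ℓ i j := by
  apply le_antisymm
  · wlog hij : i ≤ j generalizing i j
    · rw [SimpleGraph.dist_comm, cycDist_comm]
      exact this hj hi (by omega)
    have h1 := H.dist_label_add_le (i : ZMod ℓ) (j - i)
    have h2 := H.dist_label_add_le (j : ZMod ℓ) (ℓ + i - j)
    rw [Nat.cast_sub hij, add_sub_cancel] at h1
    rw [Nat.cast_sub (by omega), add_sub_cancel, Nat.cast_add, ZMod.natCast_self, zero_add,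
      SimpleGraph.dist_comm] at h2
    unfold cycDist
    omega
  · have h := le_add_dist H.unicyclic.1 (φ := fun v => cycDist ℓ i (pos G a v)) ?_
      (a (i : ZMod ℓ)) (a (j : ZMod ℓ))
    · simp only [H.pos_label hi, H.pos_label hj] at h
      have h0 : cycDist ℓ i i = 0 := by unfold cycDist; omega
      omega
    · intro u v huv
      have h1 := H.pos_adj huv
      have h2 := H.pos_lt u
      have h3 := H.pos_lt v
      unfold cycDist
      omega

lemma dist_to_label (H : Labelled G a) (s : V) {j : ℕ} (hj : j < ℓ) :
    G.dist s (a (j : ZMod ℓ)) = ht G s + cycDist ℓ (pos G a s) j := by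
  have := H.finite
  rw [H.unicyclic.dist_cycle (H.ht_label _), ← H.label_pos, H.dist_label (H.pos_lt s) hj]

lemma dist_of_pos_ne (H : Labelled G a) {s x : V} (h : pos G a s ≠ pos G a x) :
    G.dist s x = ht G s + cycDist ℓ (pos G a s) (pos G a x) + ht G x := by
  have := H.finite
  rw [H.unicyclic.dist_of_rt_ne (fun hr => h (H.pos_eq_pos.2 hr)), ← H.label_pos x,
    H.dist_to_label s (H.pos_lt x)]

lemma unresolved (H : Labelled G a) {s x y : V} (hne : pos G a x ≠ pos G a y)
    (h : G.dist s x = G.dist s y) :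
    Unresolved ℓ (pos G a x) (pos G a y) (ht G x) (ht G y) (pos G a s) := by
  have := H.finite
  by_cases h1 : pos G a s = pos G a x
  · refine .inr (.inl ⟨h1, ?_⟩)
    have h2 := H.dist_of_pos_ne (s := s) (x := y) (by omega)
    have h3 := H.unicyclic.dist_le_ht_add (H.pos_eq_pos.1 h1)
    rw [h1] at h2
    omega
  by_cases h2 : pos G a s = pos G a y
  · refine .inr (.inr ⟨h2, ?_⟩)
    have h4 := H.dist_of_pos_ne (s := s) (x := x) (by omega)
    have h3 := H.unicyclic.dist_le_ht_add (H.pos_eq_pos.1 h2)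
    rw [h2, cycDist_comm] at h4
    omega
  · refine .inl ⟨h1, h2, ?_⟩
    have h3 := H.dist_of_pos_ne h1
    have h4 := H.dist_of_pos_ne h2
    omega

/-! ### Sufficient conditions -/

lemma isMetricGenerator_of_pos (H : Labelled G a) {R : Set V} (hR : IsBranchResolving G R)
    {s t : V} (hs : s ∈ R) (ht' : t ∈ R) (hst : pos G a s ≠ pos G a t)
    (h : ∀ x y, pos G a x ≠ pos G a y → (∀ r ∈ R, G.dist r x = G.dist r y) → False) :
    IsMetricGenerator G R := by
  have := H.finite
  intro x y hne
  by_cases hp : pos G a x = pos G a y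
  · by_cases hsx : pos G a s = pos G a x
    · exact H.unicyclic.exists_dist_ne_of_rt_eq hR (H.pos_eq_pos.1 hp) hne ht'
        (fun h => hst (hsx.trans (H.pos_eq_pos.2 h).symm))
    · exact H.unicyclic.exists_dist_ne_of_rt_eq hR (H.pos_eq_pos.1 hp) hne hs
        (fun h => hsx (H.pos_eq_pos.2 h))
  · by_contra! hcon
    exact h x y hp hcon

lemma isMetricGenerator_of_triple (H : Labelled G a) {R : Set V} (hR : IsBranchResolving G R)
    {s t u : V} (hs : s ∈ R) (htR : t ∈ R) (hu : u ∈ R) (h0 : pos G a s = 0)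
    (h1 : 0 < pos G a t) (h2 : pos G a t < pos G a u) (h3 : 2 * pos G a t ≤ ℓ)
    (h4 : 2 * pos G a u ≤ ℓ + 2 * pos G a t) (h5 : ℓ ≤ 2 * pos G a u) :
    IsMetricGenerator G R := by
  refine H.isMetricGenerator_of_pos hR hs htR (by omega) fun x y hne hd => ?_
  have us := H.unresolved hne (hd s hs)
  rw [h0] at us
  exact Unresolved.false_of_triple h1 h2 (H.pos_lt u) hne (H.pos_lt x) (H.pos_lt y) h3 h4 h5
    us (H.unresolved hne (hd t htR)) (H.unresolved hne (hd u hu))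

/-- An unresolved `x` above an end satisfies `ht x = d + ht y`. A landmark in the same branch as `x`
reaches it without descending to the cycle, hence is strictly closer to `x` than to `y`. -/
lemma end_resolved (H : Labelled G a) {R : Set V} {s t : V} (hs : s ∈ R) (htR : t ∈ R)
    {j : ℕ} (h0 : pos G a s = 0) (hj : pos G a t = j) (hj1 : 1 ≤ j) (hjl : 2 * j < ℓ)
    (hch : 2 * j + 1 < ℓ → ∀ w, (w ∈ children G (a 0) ∨ w ∈ children G (a (j : ZMod ℓ))) →
      ∃ r ∈ R, IsDesc G w r)
    {x y : V} (hne : pos G a x ≠ pos G a y) (hd : ∀ r ∈ R, G.dist r x = G.dist r y)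
    (hx : 0 = pos G a x ∨ j = pos G a x) : False := by
  have := H.finite
  have us := H.unresolved hne (hd s hs)
  have ut := H.unresolved hne (hd t htR)
  rw [h0] at us
  rw [hj] at ut
  obtain ⟨h1, h2⟩ := Unresolved.ht_eq_of_end hj1 hjl hne (H.pos_lt y) hx us ut
  have hxpos : 0 < ht G x := by
    have hlx := H.pos_lt x
    have hly := H.pos_lt y
    have : 0 < cycDist ℓ (pos G a x) (pos G a y) := by unfold cycDist; omega
    omega
  obtain ⟨w, hw, hwx⟩ := H.unicyclic.exists_child (isDesc_rt x)
    (by rw [H.unicyclic.ht_rt]; exact hxpos)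
  have hw' : w ∈ children G (a 0) ∨ w ∈ children G (a (j : ZMod ℓ)) := by
    rw [← H.label_pos x] at hw
    rcases hx with hx | hx
    · rw [← hx, Nat.cast_zero] at hw
      exact .inl hw
    · rw [← hx] at hw
      exact .inr hw
  obtain ⟨r, hr, hwr⟩ := hch h2 w hw'
  have h3 := H.unicyclic.dist_le_of_common hwr hwx
  have h4 : pos G a r = pos G a x := by
    rw [← H.pos_of_isDesc hwr, H.pos_of_isDesc hwx]
  have h5 := H.dist_of_pos_ne (s := r) (x := y) (by omega)
  rw [h4, ← hd r hr] at h5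
  have := hw.1
  omega

/-- `hch` handles pairs with a vertex above an end, `htriv` pairs beyond the ends, and `hshort`
pairs split by the ends. -/
lemma isMetricGenerator_of_ends (H : Labelled G a) {R : Set V} (hR : IsBranchResolving G R)
    {s t : V} (hs : s ∈ R) (htR : t ∈ R) {j k : ℕ} (hk : ℓ = 2 * k + 2 ∨ ℓ = 2 * k + 3)
    (h0 : pos G a s = 0) (hj : pos G a t = j) (hj1 : 1 ≤ j) (hjl : 2 * j < ℓ)
    (hch : 2 * j + 1 < ℓ → ∀ w, (w ∈ children G (a 0) ∨ w ∈ children G (a (j : ZMod ℓ))) →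
      ∃ r ∈ R, IsDesc G w r)
    (htriv : ∀ x, (j < pos G a x ∧ pos G a x ≤ k) ∨ ℓ + j ≤ pos G a x + k → ht G x = 0)
    (hshort : ℓ = 2 * k + 2 → (∃ r ∈ R, 0 < pos G a r ∧ pos G a r < j) ∨
      ∀ x, 0 < pos G a x → pos G a x < j → ht G x + j ≤ k) :
    IsMetricGenerator G R := by
  refine H.isMetricGenerator_of_pos hR hs htR (by omega) fun x y hne hd => ?_
  wlog hlt : pos G a x < pos G a y generalizing x y
  · exact this y x hne.symm (fun r hr => (hd r hr).symm) (by omega)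
  by_cases hx : 0 = pos G a x ∨ j = pos G a x
  · exact H.end_resolved hs htR h0 hj hj1 hjl hch hne hd hx
  by_cases hy : 0 = pos G a y ∨ j = pos G a y
  · exact H.end_resolved hs htR h0 hj hj1 hjl hch hne.symm (fun r hr => (hd r hr).symm) hy
  have us := H.unresolved hne (hd s hs)
  have ut := H.unresolved hne (hd t htR)
  rw [h0] at us
  rw [hj] at ut
  by_cases hthird : ∃ r ∈ R, 0 < pos G a r ∧ pos G a r < j
  · obtain ⟨r, hr, hr0, hrj⟩ := hthird
    exact Unresolved.false_of_off_ends hj1 hjl hk hlt (H.pos_lt y) (by omega) (by omega)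
      (by omega) (htriv x) (htriv y) (fun _ => .inl ⟨hr0, hrj, H.unresolved hne (hd r hr)⟩) us ut
  -- The value of `i` is a dummy: the height alternative is taken.
  · exact Unresolved.false_of_off_ends (i := 0) hj1 hjl hk hlt (H.pos_lt y) (by omega) (by omega)
      (by omega) (htriv x) (htriv y)
      (fun h => .inr fun hxj => (hshort h).resolve_left hthird x (by omega) hxj) us ut

end Labelled

end

section

/-! ### Heights in trees -/

namespace IsUnicyclic

/-- A new landmark for `c` is placed off the cycle if possible, so that it lies below the child when
there is only one. -/
lemma exists_rt_eq_and (hG : IsUnicyclic G) {c : V} (hc : c ∈ cycleVerts G) :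
    ∃ x, rt G x = c ∧ (0 < ht G x ∨ children G c = ∅) := by
  have h0 := hG.ht_eq_zero.2 hc
  rcases Set.eq_empty_or_nonempty (children G c) with h | ⟨w, hw⟩
  · exact ⟨c, rt_of_ht_eq_zero h0, .inr h⟩
  · exact ⟨w, by rw [hG.rt_of_mem_children hw, rt_of_ht_eq_zero h0], .inl hw.1⟩

variable [Finite V]

lemma ht_le_treeLength (hG : IsUnicyclic G) {c x : V} (hc : c ∈ cycleVerts G)
    (hx : x ∈ treeVerts G c) : ht G x ≤ treeLength G c := by
  have h1 : Set.Iic (ht G x) ⊆ ht G '' treeVerts G c := by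
    intro n hn
    rw [Set.mem_Iic] at hn
    refine ⟨(par G)^[ht G x - n] x, ?_, by rw [hG.ht_iterate]; omega⟩
    rw [hG.mem_treeVerts hc] at hx ⊢
    rw [hG.rt_eq_of_isDesc ⟨_, rfl⟩, hx]
  have h2 := Set.ncard_le_ncard h1 (Set.toFinite _)
  have h3 := Set.ncard_image_le (f := ht G) (Set.toFinite (treeVerts G c))
  rw [Set.ncard_eq_toFinset_card', Set.toFinset_Iic, Nat.card_Iic] at h2
  unfold treeLength
  omega

/-- Without branching vertices the height is injective on the tree, so a tree with `n + 1` vertices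
cannot have all heights below `n`. -/
lemma exists_ht_eq (hG : IsUnicyclic G) {c : V} (hc : c ∈ cycleVerts G)
    (hb : ∀ w ∈ treeVerts G c, ¬ IsBranching G w) {n : ℕ} (hn : n ≤ treeLength G c) :
    ∃ x ∈ treeVerts G c, ht G x = n := by
  by_cases h : ∃ y ∈ treeVerts G c, n ≤ ht G y
  · obtain ⟨y, hy, hny⟩ := h
    refine ⟨(par G)^[ht G y - n] y, ?_, by rw [hG.ht_iterate]; omega⟩
    rw [hG.mem_treeVerts hc] at hy ⊢
    rw [hG.rt_eq_of_isDesc ⟨_, rfl⟩, hy]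
  push Not at h
  have hinj : Set.InjOn (ht G) (treeVerts G c) := by
    intro x hx y hy hxy
    by_contra hne
    rw [hG.mem_treeVerts hc] at hx hy
    obtain ⟨v, w, hw, w', hw', hne', h1, -⟩ := hG.exists_meet (hx.trans hy.symm) hxy hne
    refine hb v ?_ (hG.isBranching_iff.2 ((Set.one_lt_ncard (Set.toFinite _)).2
      ⟨w, hw, w', hw', hne'⟩))
    rw [hG.mem_treeVerts hc, ← hG.rt_of_mem_children hw, hG.rt_eq_of_isDesc h1, hx]
  have h1 : ht G '' treeVerts G c ⊆ Set.Iio n := by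
    rintro _ ⟨y, hy, rfl⟩
    exact h y hy
  have h2 := Set.ncard_le_ncard h1 (Set.toFinite _)
  rw [hinj.ncard_image, Set.ncard_eq_toFinset_card' (Set.Iio n), Set.toFinset_Iio,
    Nat.card_Iio] at h2
  have hcT : c ∈ treeVerts G c :=
    (hG.mem_treeVerts hc).2 (rt_of_ht_eq_zero (hG.ht_eq_zero.2 hc))
  have h3 := (Set.ncard_pos (Set.toFinite (treeVerts G c))).2 ⟨c, hcT⟩
  have h4 := h c hcT
  unfold treeLength at hn
  omega

end IsUnicyclic

variable {ℓ : ℕ} {a : ZMod ℓ → V}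

namespace Labelled

lemma mem_cycleVerts (H : Labelled G a) (i : ZMod ℓ) : a i ∈ cycleVerts G :=
  H.unicyclic.ht_eq_zero.1 (H.ht_label i)

lemma mem_treeVerts (H : Labelled G a) {i : ℕ} (hi : i < ℓ) {x : V} :
    x ∈ treeVerts G (a (i : ZMod ℓ)) ↔ pos G a x = i := by
  have := H.finite
  rw [H.unicyclic.mem_treeVerts (H.mem_cycleVerts _), H.rt_eq_iff hi]

lemma mem_active (H : Labelled G a) {R : Set V} {i : ℕ} (hi : i < ℓ) :
    a (i : ZMod ℓ) ∈ active G R ↔ ∃ r ∈ R, pos G a r = i := by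
  have := H.finite
  rw [H.unicyclic.mem_active]
  simp only [H.rt_eq_iff hi]

/-! ### Rotations -/

lemma rotate (H : Labelled G a) (c : ZMod ℓ) : Labelled G (fun i => a (i + c)) where
  finite := H.finite
  unicyclic := H.unicyclic
  length := H.length
  labelling := by
    refine ⟨H.three_le, fun i j h => ?_, fun i => ?_⟩
    · simpa using H.labelling.2.1 h
    · have := H.labelling.2.2 (i + c)
      rwa [add_right_comm] at this

lemma pos_rotate (H : Labelled G a) {c : ℕ} (hc : c < ℓ) (v : V) :
    (c ≤ pos G a v ∧ pos G (fun i => a (i + (c : ZMod ℓ))) v + c = pos G a v) ∨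
      (pos G a v < c ∧ pos G (fun i => a (i + (c : ZMod ℓ))) v + c = pos G a v + ℓ) := by
  have hv := H.pos_lt v
  rcases le_or_gt c (pos G a v) with h | h
  · refine .inl ⟨h, ?_⟩
    rw [(H.rotate c).pos_eq (i := pos G a v - c) (by omega)]
    · omega
    · rw [← H.label_pos v, Nat.cast_sub h, sub_add_cancel]
  · refine .inr ⟨h, ?_⟩
    rw [(H.rotate c).pos_eq (i := pos G a v + ℓ - c) (by omega)]
    · omega
    · rw [← H.label_pos v, Nat.cast_sub (by omega), sub_add_cancel, Nat.cast_add,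
        ZMod.natCast_self, add_zero]

/-! ### Geodesic triples -/

lemma hasTriple (H : Labelled G a) {R : Set V} {s t u : V} (hs : s ∈ R) (htR : t ∈ R)
    (hu : u ∈ R) (h1 : pos G a s < pos G a t) (h2 : pos G a t < pos G a u)
    (h3 : 2 * pos G a t ≤ ℓ + 2 * pos G a s) (h4 : 2 * pos G a u ≤ ℓ + 2 * pos G a t)
    (h5 : ℓ + 2 * pos G a s ≤ 2 * pos G a u) : HasActiveGeodesicTriple G R := by
  have := H.finite
  have ls := H.pos_lt s
  have lt' := H.pos_lt t
  have lu := H.pos_lt u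
  have hact : ∀ v ∈ R, a (pos G a v : ZMod ℓ) ∈ active G R :=
    fun v hv => (H.mem_active (H.pos_lt v)).2 ⟨v, hv, rfl⟩
  refine ⟨_, hact s hs, _, hact t htR, _, hact u hu, ?_, ?_, ?_, ?_⟩
  · intro h; have := H.labelling.eq_of_natCast ls lt' h; omega
  · intro h; have := H.labelling.eq_of_natCast lt' lu h; omega
  · intro h; have := H.labelling.eq_of_natCast lu ls h; omega
  · rw [H.dist_label ls lt', H.dist_label lt' lu, H.dist_label lu ls, H.length]
    unfold cycDist
    omega

lemma isMetricGenerator_of_hasTriple (H : Labelled G a) {R : Set V} (hR : IsBranchResolving G R)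
    (hT : HasActiveGeodesicTriple G R) : IsMetricGenerator G R := by
  have := H.finite
  have key : ∀ s ∈ R, ∀ t ∈ R, ∀ u ∈ R, pos G a s < pos G a t → pos G a t < pos G a u →
      cycDist ℓ (pos G a s) (pos G a t) + cycDist ℓ (pos G a t) (pos G a u) +
        cycDist ℓ (pos G a u) (pos G a s) = ℓ → IsMetricGenerator G R := by
    intro s hs t htR u hu h1 h2 h3
    have ls := H.pos_lt s
    have lu := H.pos_lt u
    have e1 := H.pos_rotate ls s
    have e2 := H.pos_rotate ls t
    have e3 := H.pos_rotate ls u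
    have f1 := cycDist_cases (ℓ := ℓ) h1.le (by omega)
    have f2 := cycDist_cases (ℓ := ℓ) h2.le (by omega)
    have f3 := cycDist_cases' (ℓ := ℓ) (h1.trans h2).le (by omega)
    apply (H.rotate (pos G a s : ZMod ℓ)).isMetricGenerator_of_triple hR hs htR hu <;> omega
  obtain ⟨x, hx, y, hy, z, hz, hxy, hyz, hzx, hsum⟩ := hT
  rw [H.unicyclic.mem_active] at hx hy hz
  obtain ⟨s, hs, rfl⟩ := hx
  obtain ⟨t, htR, rfl⟩ := hy
  obtain ⟨u, hu, rfl⟩ := hz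
  rw [Ne, ← H.pos_eq_pos] at hxy hyz hzx
  rw [← H.label_pos s, ← H.label_pos t, ← H.label_pos u, H.dist_label (H.pos_lt s) (H.pos_lt t),
    H.dist_label (H.pos_lt t) (H.pos_lt u), H.dist_label (H.pos_lt u) (H.pos_lt s),
    H.length] at hsum
  have c1 := cycDist_comm ℓ (pos G a s) (pos G a t)
  have c2 := cycDist_comm ℓ (pos G a t) (pos G a u)
  have c3 := cycDist_comm ℓ (pos G a u) (pos G a s)
  -- Sort the three positions; two of the eight sign patterns are cyclic and contradictory.
  rcases lt_or_gt_of_ne hxy with h1 | h1 <;> rcases lt_or_gt_of_ne hyz with h2 | h2 <;>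
    rcases lt_or_gt_of_ne hzx with h3 | h3
  · omega
  · exact key s hs t htR u hu h1 h2 (by omega)
  · exact key u hu s hs t htR h3 h1 (by omega)
  · exact key s hs u hu t htR h3 h2 (by omega)
  · exact key t htR u hu s hs h2 h3 (by omega)
  · exact key t htR s hs u hu h1 h3 (by omega)
  · exact key u hu t htR s hs h2 h1 (by omega)
  · omega

/-! ### Sufficiency of the conditions on the graph -/

lemma isMetricGenerator_of_graph (H : Labelled G a) {R : Set V} (hR : IsBranchResolving G R)
    {j : ℕ} {s t : V} (hs : s ∈ R) (htR : t ∈ R) (hs0 : rt G s = a 0)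
    (hs1 : 0 < ht G s ∨ children G (a 0) = ∅) (ht0 : rt G t = a (j : ZMod ℓ))
    (ht1 : 0 < ht G t ∨ children G (a (j : ZMod ℓ)) = ∅)
    (hgr : IsOddGraph G a j ∨ IsEvenGraph G a j) : IsMetricGenerator G R := by
  have := H.finite
  have h3 := H.three_le
  obtain ⟨k, hk⟩ : ∃ k, k = (ℓ - 2) / 2 := ⟨_, rfl⟩
  have hj : 1 ≤ j ∧ 2 * j < ℓ := by
    rcases hgr with ⟨-, ⟨h1, h2⟩, -⟩ | ⟨-, ⟨h1, h2⟩, -⟩ <;> omega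
  have hbad : 2 * j + 1 < ℓ → CondBad G a j := by
    intro h
    rcases hgr with ⟨⟨n, hn⟩, -, h1 | h1⟩ | ⟨-, -, h1, -⟩
    · omega
    · exact h1.1
    · exact h1
  have htriv : j < k → CondTrivial G a j := by
    intro h
    rcases hgr with ⟨⟨n, hn⟩, -, h1 | h1⟩ | ⟨-, -, -, h1, -⟩
    · omega
    · exact h1.2
    · exact h1
  have hs0' : rt G s = a ((0 : ℕ) : ZMod ℓ) := by rw [Nat.cast_zero]; exact hs0
  refine H.isMetricGenerator_of_ends hR hs htR (k := k) (by omega) (H.pos_eq (by omega) hs0')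
    (H.pos_eq (by omega) ht0) hj.1 hj.2 ?_ ?_ ?_
  · intro hlt w hw
    rcases hw with hw | hw
    · exact H.unicyclic.exists_isDesc_of_not_isBad hR (H.mem_cycleVerts _) (hbad hlt).1 hw hs hs0
        hs1
    · exact H.unicyclic.exists_isDesc_of_not_isBad hR (H.mem_cycleVerts _) (hbad hlt).2 hw htR ht0
        ht1
  · intro x hx
    have hxl := H.pos_lt x
    have hjk : j < k := by omega
    have h1 := htriv hjk (hk ▸ hjk) (pos G a x)
      (by simp only [Set.mem_union, Set.mem_Icc]; omega)
    have h2 : x ∈ treeVerts G (a (pos G a x : ZMod ℓ)) := (H.mem_treeVerts hxl).2 rfl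
    rw [h1] at h2
    rw [Set.mem_singleton_iff.1 h2]
    exact H.ht_label _
  · intro hl
    have hsh : CondShort G a j := by
      rcases hgr with ⟨⟨n, hn⟩, -⟩ | ⟨-, -, -, -, h⟩
      · omega
      · exact h
    by_cases hb : ∀ k ∈ Set.Icc 1 (j - 1), ∀ w ∈ treeVerts G (a (k : ZMod ℓ)), ¬ IsBranching G w
    · refine .inr fun x hx0 hxj => ?_
      have h1 := hsh (by omega) hb (pos G a x) ⟨hx0, by omega⟩
      have h2 := H.unicyclic.ht_le_treeLength (H.mem_cycleVerts (pos G a x : ZMod ℓ))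
        ((H.mem_treeVerts (H.pos_lt x)).2 rfl)
      omega
    -- A branching vertex between the ends forces a landmark into its tree, which serves as third
    -- landmark.
    · left
      push Not at hb
      obtain ⟨i, ⟨hi1, hi2⟩, w, hw, hbr⟩ := hb
      obtain ⟨r, hr, hrw⟩ := H.unicyclic.exists_rt_eq_of_isBranching hR hbr
      rw [H.mem_treeVerts (by omega)] at hw
      have := H.pos_eq_pos.2 hrw
      exact ⟨r, hr, by omega, by omega⟩

end Labelled

end

section

variable {ℓ : ℕ} {a : ZMod ℓ → V}

namespace Labelled

/-! ### Necessary conditions -/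

/-- Landmarks in the tree of `s` cannot resolve the two cycle neighbours of its root. -/
lemma exists_pos_ne (H : Labelled G a) {R : Set V} (hR : IsMetricGenerator G R) :
    ∃ s ∈ R, ∃ t ∈ R, pos G a s ≠ pos G a t := by
  have := H.finite
  have h3 := H.three_le
  have hne : ∀ i : ZMod ℓ, a (i + 1) ≠ a (i - 1) := by
    intro i h
    have h1 := H.labelling.2.1 h
    refine absurd ?_ (H.labelling.natCast_ne_zero (n := 2) (by omega) (by omega))
    push_cast
    linear_combination h1
  obtain ⟨s, hs, -⟩ := hR _ _ (hne 0)
  obtain ⟨t, htR, hd⟩ := hR _ _ (hne (pos G a s : ZMod ℓ))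
  refine ⟨s, hs, t, htR, fun hst => hd ?_⟩
  have h1 : G.Adj (rt G t) (a ((pos G a s : ZMod ℓ) + 1)) := by
    rw [← H.label_pos t, ← hst]
    exact H.labelling.2.2 _
  have h2 : G.Adj (rt G t) (a ((pos G a s : ZMod ℓ) - 1)) := by
    rw [← H.label_pos t, ← hst]
    have := H.labelling.2.2 ((pos G a s : ZMod ℓ) - 1)
    rw [sub_add_cancel] at this
    exact this.symm
  rw [H.unicyclic.dist_cycle (s := t) (H.ht_label ((pos G a s : ZMod ℓ) + 1)),
    H.unicyclic.dist_cycle (s := t) (H.ht_label ((pos G a s : ZMod ℓ) - 1)),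
    SimpleGraph.dist_eq_one_iff_adj.2 h1, SimpleGraph.dist_eq_one_iff_adj.2 h2]

/-- The reflection of the cycle fixing 0 and `j` swaps indices 1 and `ℓ - 1`. -/
lemma not_antipodal (H : Labelled G a) {R : Set V} (hR : IsMetricGenerator G R) {j : ℕ}
    (hj : 2 * j = ℓ) (h : ∀ r ∈ R, pos G a r = 0 ∨ pos G a r = j) : False := by
  have h3 := H.three_le
  obtain ⟨r, hr, hd⟩ := hR (a (1 : ℕ)) (a ((ℓ - 1 : ℕ) : ZMod ℓ)) (fun h => by
    have := H.labelling.eq_of_natCast (by omega) (by omega) h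
    omega)
  rw [H.dist_to_label r (by omega), H.dist_to_label r (by omega)] at hd
  have := h r hr
  unfold cycDist at hd
  omega

/-- If no landmark lay below `w`, every landmark would reach `w` through `a p`, at the same distance
as `a q`. With `q` the next index away from the landmarks, this yields both (i) and (ii). -/
lemma hit_of_isMetricGenerator (H : Labelled G a) {R : Set V} (hR : IsMetricGenerator G R)
    {j p q : ℕ} (hp : p < ℓ) (hq : q < ℓ) (hRj : ∀ r ∈ R, pos G a r ≤ j)
    (hpq : ∀ r ≤ j, cycDist ℓ r p + 1 = cycDist ℓ r q) {w : V}
    (hw : w ∈ children G (a (p : ZMod ℓ))) : ∃ r ∈ R, IsDesc G w r := by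
  have := H.finite
  by_contra! hcon
  obtain ⟨r, hr, hd⟩ := hR w (a (q : ZMod ℓ)) (fun h => by
    have h1 := hw.1
    rw [h, H.ht_label] at h1
    omega)
  rw [H.unicyclic.dist_eq_dist_par_add_one hw.1 (hcon r hr), hw.2, H.dist_to_label r hp,
    H.dist_to_label r hq] at hd
  have := hpq _ (hRj r hr)
  omega

/-- At the critical height `k + 1 - j`, the vertex `y` and the cycle vertex of index `j + k + 1 -
pos y` are equidistant from both ends. -/
lemma ht_ne_of_isMetricGenerator (H : Labelled G a) {R : Set V} (hR : IsMetricGenerator G R)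
    {j k : ℕ} (hk : ℓ = 2 * k + 2) (hjk : j ≤ k) (hRj : ∀ r ∈ R, pos G a r = 0 ∨ pos G a r = j)
    {y : V} (hy0 : 0 < pos G a y) (hyj : pos G a y < j) : ht G y + j ≠ k + 1 := by
  intro hy
  have hyl := H.pos_lt y
  obtain ⟨r, hr, hd⟩ := hR y (a ((j + k + 1 - pos G a y : ℕ) : ZMod ℓ)) (fun h => by
    have h1 := H.ht_label ((j + k + 1 - pos G a y : ℕ) : ZMod ℓ)
    rw [← h] at h1
    omega)
  have h1 := hRj r hr
  rw [H.dist_to_label r (by omega), H.dist_of_pos_ne (by omega)] at hd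
  unfold cycDist at hd
  omega

lemma graph_of_isMetricGenerator (H : Labelled G a) {R : Set V} (hR : IsMetricGenerator G R)
    {j : ℕ} (hj : 1 ≤ j) (hjl : 2 * j < ℓ) (hRj : ∀ r ∈ R, pos G a r ≤ j)
    (hb0 : IsBad G (a 0) → ∃ w ∈ children G (a 0), ∀ r ∈ R, ¬ IsDesc G w r)
    (hbj : IsBad G (a (j : ZMod ℓ)) →
      ∃ w ∈ children G (a (j : ZMod ℓ)), ∀ r ∈ R, ¬ IsDesc G w r)
    (hin : (∀ k ∈ Set.Icc 1 (j - 1), ∀ w ∈ treeVerts G (a (k : ZMod ℓ)), ¬ IsBranching G w) →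
      ∀ r ∈ R, pos G a r = 0 ∨ pos G a r = j) :
    (Odd ℓ → IsOddGraph G a j) ∧ (Even ℓ → IsEvenGraph G a j) := by
  have := H.finite
  have h3 := H.three_le
  have hbad : 2 * j + 1 < ℓ → CondBad G a j := by
    intro hlt
    constructor
    · intro hb
      obtain ⟨w, hw, hun⟩ := hb0 hb
      have hw' : w ∈ children G (a ((0 : ℕ) : ZMod ℓ)) := by rw [Nat.cast_zero]; exact hw
      obtain ⟨r, hr, hd⟩ := H.hit_of_isMetricGenerator hR (q := ℓ - 1) (by omega) (by omega) hRj
        (fun r hr => by unfold cycDist; omega) hw'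
      exact hun r hr hd
    · intro hb
      obtain ⟨w, hw, hun⟩ := hbj hb
      obtain ⟨r, hr, hd⟩ := H.hit_of_isMetricGenerator hR (q := j + 1) (by omega) (by omega) hRj
        (fun r hr => by unfold cycDist; omega) hw
      exact hun r hr hd
  have htriv : CondTrivial G a j := by
    intro hlt i hi
    have hil : i < ℓ := by
      simp only [Set.mem_union, Set.mem_Icc] at hi; omega
    have hij : j < i := by
      simp only [Set.mem_union, Set.mem_Icc] at hi; omega
    have hch : ∀ w ∈ children G (a (i : ZMod ℓ)), False := by
      intro w hw
      have hwi : pos G a w = i := by rw [H.pos_of_mem_children hw, H.pos_label hil]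
      have hhit : ∃ r ∈ R, IsDesc G w r := by
        rcases hi with ⟨h1, h2⟩ | ⟨h1, h2⟩
        · exact H.hit_of_isMetricGenerator hR (q := i - 1) hil (by omega) hRj
            (fun r hr => by unfold cycDist; omega) hw
        · exact H.hit_of_isMetricGenerator hR (q := i + 1) hil (by omega) hRj
            (fun r hr => by unfold cycDist; omega) hw
      obtain ⟨r, hr, hd⟩ := hhit
      have h1 := hRj r hr
      have h2 := H.pos_of_isDesc hd
      omega
    ext x
    rw [H.mem_treeVerts hil, Set.mem_singleton_iff]
    constructor
    · intro hx
      have hrx := (H.rt_eq_iff hil).2 hx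
      rcases Nat.eq_zero_or_pos (ht G x) with h0 | h0
      · rw [← hrx, rt_of_ht_eq_zero h0]
      · obtain ⟨w, hw, -⟩ := H.unicyclic.exists_child (isDesc_rt x)
          (by rw [H.unicyclic.ht_rt]; exact h0)
        rw [hrx] at hw
        exact (hch w hw).elim
    · rintro rfl
      exact H.pos_label hil
  refine ⟨fun hodd => ⟨hodd, ⟨hj, by omega⟩, ?_⟩, fun heven => ⟨heven, ⟨hj, by omega⟩, ?_⟩⟩
  · rcases Nat.lt_or_ge (2 * j + 1) ℓ with h | h
    · exact .inr ⟨hbad h, htriv⟩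
    · exact .inl (by omega)
  · obtain ⟨n, hn⟩ := heven
    refine ⟨hbad (by omega), htriv, fun hj1 hbr i hi => ?_⟩
    obtain ⟨hi1, hi2⟩ := hi
    by_contra hcon
    obtain ⟨y, hy, hyh⟩ := H.unicyclic.exists_ht_eq (H.mem_cycleVerts (i : ZMod ℓ))
      (hbr i ⟨hi1, hi2⟩) (n := (ℓ - 2) / 2 - j + 1) (by omega)
    rw [H.mem_treeVerts (by omega)] at hy
    exact H.ht_ne_of_isMetricGenerator hR (k := (ℓ - 2) / 2) (by omega) (by omega) (hin hbr)
      (y := y) (by omega) (by omega) (by omega)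

end Labelled

end

section

variable {ℓ : ℕ} {a : ZMod ℓ → V}

lemma metricDim_eq {n : ℕ} {R : Set V} (hR : IsMetricGenerator G R) (hn : R.ncard ≤ n)
    (h : ∀ R' : Set V, IsMetricGenerator G R' → n ≤ R'.ncard) : metricDim G = n := by
  apply le_antisymm
  · exact (Nat.sInf_le ⟨R, hR, rfl⟩ : metricDim G ≤ R.ncard).trans hn
  · obtain ⟨R', hR', he⟩ := Nat.sInf_mem
      (s := {k : ℕ | ∃ S : Set V, IsMetricGenerator G S ∧ S.ncard = k}) ⟨_, R, hR, rfl⟩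
    exact (h R' hR').trans he.le

lemma IsBad.isBranching {v : V} (h : IsBad G v) : IsBranching G v := .inl ⟨h.1, h.2.1⟩

namespace Labelled

/-! ### Normal labellings -/

lemma maxActiveIndex_spec (H : Labelled G a) {R : Set V} (hR : R.Nonempty) :
    (∃ r ∈ R, pos G a r = maxActiveIndex G R a) ∧ ∀ r ∈ R, pos G a r ≤ maxActiveIndex G R a := by
  have hset : {i : ℕ | i < ℓ ∧ a (i : ZMod ℓ) ∈ active G R} = pos G a '' R := by
    ext i
    constructor
    · rintro ⟨hi, h⟩
      exact (H.mem_active hi).1 h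
    · rintro ⟨r, hr, rfl⟩
      exact ⟨H.pos_lt r, (H.mem_active (H.pos_lt r)).2 ⟨r, hr, rfl⟩⟩
  have hbdd : BddAbove (pos G a '' R) := ⟨ℓ, by rintro _ ⟨r, -, rfl⟩; exact (H.pos_lt r).le⟩
  rw [maxActiveIndex, hset]
  refine ⟨?_, fun r hr => le_csSup hbdd ⟨r, hr, rfl⟩⟩
  exact Nat.sSup_mem (hR.image _) hbdd

/-- Compare with the labelling rotated to start at `r'`: the gap following the last active index of
a normal labelling is a largest one. -/
lemma normal_gap (H : Labelled G a) {S : Set V} (hn : IsNormalLabelling G S a) {r r' : V}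
    (hr' : r' ∈ S)
    (h : ∀ t ∈ S, pos G a t ≤ pos G a r ∨ pos G a r' ≤ pos G a t) :
    maxActiveIndex G S a + pos G a r' ≤ ℓ + pos G a r := by
  have hl := H.pos_lt r'
  have Hb := H.rotate (pos G a r' : ZMod ℓ)
  have hb := hn.2.2 _ Hb.labelling (by
    rw [zero_add]
    exact (H.mem_active hl).2 ⟨r', hr', rfl⟩)
  obtain ⟨t, htS, he⟩ := (Hb.maxActiveIndex_spec ⟨r', hr'⟩).1
  have h1 := H.pos_rotate hl t
  have h2 := h t htS
  have h3 := H.pos_lt t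
  omega

lemma normal_cases (H : Labelled G a) {S : Set V} (hn : IsNormalLabelling G S a) {s t : V}
    (hs : s ∈ S) (htS : t ∈ S) (h0 : pos G a s = 0) (ht0 : pos G a t = maxActiveIndex G S a)
    (hT : ¬ HasActiveGeodesicTriple G S) :
    2 * maxActiveIndex G S a < ℓ ∨ (2 * maxActiveIndex G S a = ℓ ∧
      ∀ r ∈ S, pos G a r = 0 ∨ pos G a r = maxActiveIndex G S a) := by
  have := H.finite
  have hmax := (H.maxActiveIndex_spec ⟨s, hs⟩).2
  generalize hj : maxActiveIndex G S a = j at *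
  have gap : ∀ r r', r' ∈ S →
      (∀ t ∈ S, pos G a t ≤ pos G a r ∨ pos G a r' ≤ pos G a t) →
      j + pos G a r' ≤ ℓ + pos G a r := by
    intro r r' hr' h
    have := H.normal_gap hn hr' h
    rwa [hj] at this
  by_contra! hcon
  obtain ⟨hc1, hc2⟩ := hcon
  have htl := H.pos_lt t
  by_cases hlt : 2 * j = ℓ
  · obtain ⟨r, hr, hr0, hrj⟩ := hc2 hlt
    have := hmax r hr
    exact hT (H.hasTriple hs hr htS (by omega) (by omega) (by omega) (by omega) (by omega))
  -- The active positions `r`, `r'` straddle ℓ/2. Their gap is at most `ℓ - j < ℓ/2`, which makes 0,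
  -- `r` and `j` a geodesic triple.
  obtain ⟨r, ⟨hr, hrl⟩, hrmax⟩ := Set.exists_max_image {r | r ∈ S ∧ 2 * pos G a r ≤ ℓ} (pos G a)
    (Set.toFinite _) ⟨s, hs, by omega⟩
  obtain ⟨r', ⟨hr', hrl'⟩, hrmin⟩ := Set.exists_min_image {r' | r' ∈ S ∧ ℓ < 2 * pos G a r'}
    (pos G a) (Set.toFinite _) ⟨t, htS, by omega⟩
  have h1 := gap r r' hr' (fun u hu => by
    rcases le_or_gt (2 * pos G a u) ℓ with h | h
    · exact .inl (hrmax u ⟨hu, h⟩)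
    · exact .inr (hrmin u ⟨hu, h⟩))
  have h2 : pos G a r ≠ 0 := by
    intro h2
    have := hmax r' hr'
    omega
  exact hT (H.hasTriple hs hr htS (by omega) (by omega) (by omega) (by omega) (by omega))

end Labelled

namespace IsUnicyclic

variable [Finite V]

lemma exists_labelled (hG : IsUnicyclic G) (hℓ : cycleLength G = ℓ) {c : V}
    (hc : c ∈ cycleVerts G) : ∃ a : ZMod ℓ → V, Labelled G a ∧ a 0 = c := by
  obtain ⟨a, ha⟩ := hG.exists_labelling hℓ
  have H : Labelled G a := ⟨inferInstance, hG, ha, hℓ⟩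
  rw [ha.cycleVerts_eq hℓ] at hc
  obtain ⟨i, rfl⟩ := hc
  exact ⟨_, H.rotate i, by simp⟩

/-- Starting at the appropriate one of the two vertices makes the arc at most half the cycle without
reversing direction. -/
lemma exists_labelled_pair (hG : IsUnicyclic G) (hℓ : cycleLength G = ℓ) {c c' : V}
    (hc : c ∈ cycleVerts G) (hc' : c' ∈ cycleVerts G) (hne : c ≠ c') :
    ∃ a : ZMod ℓ → V, Labelled G a ∧ ∃ j : ℕ, 1 ≤ j ∧ 2 * j ≤ ℓ ∧
      ((a 0 = c ∧ a (j : ZMod ℓ) = c') ∨ (a 0 = c' ∧ a (j : ZMod ℓ) = c)) := by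
  obtain ⟨a, H, rfl⟩ := hG.exists_labelled hℓ hc
  have hl := H.pos_lt c'
  have hp := H.label_pos c'
  rw [rt_of_ht_eq_zero (hG.ht_eq_zero.2 hc')] at hp
  have h0 : pos G a c' ≠ 0 := by
    intro h
    rw [h, Nat.cast_zero] at hp
    exact hne hp
  rcases le_or_gt (2 * pos G a c') ℓ with h | h
  · exact ⟨a, H, pos G a c', by omega, h, .inl ⟨rfl, hp⟩⟩
  · refine ⟨_, H.rotate (pos G a c' : ZMod ℓ), ℓ - pos G a c', by omega, by omega, .inr ⟨?_, ?_⟩⟩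
    · rw [zero_add, hp]
    · rw [Nat.cast_sub hl.le, sub_add_cancel, ZMod.natCast_self]

lemma branchNumber_le_of_isMetricGenerator (hG : IsUnicyclic G) {R : Set V}
    (hR : IsMetricGenerator G R) : branchNumber G ≤ R.ncard :=
  branchNumber_le (hG.isBranchResolving_of_isMetricGenerator hR)

lemma exists_rt_ne (hG : IsUnicyclic G) {R : Set V} (hR : IsMetricGenerator G R) :
    ∃ s ∈ R, ∃ t ∈ R, rt G s ≠ rt G t := by
  obtain ⟨c, hc⟩ := hG.cycleVerts_nonempty
  obtain ⟨a, H, -⟩ := hG.exists_labelled rfl hc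
  obtain ⟨s, hs, t, htR, hne⟩ := H.exists_pos_ne hR
  exact ⟨s, hs, t, htR, fun h => hne (H.pos_eq_pos.2 h)⟩

/-! ### At least two active vertices -/

lemma metricDim_of_two_active (hG : IsUnicyclic G) (hℓ : cycleLength G = ℓ) {S : Set V}
    (hS : S ∈ minBranchSets G) (hA : 2 ≤ (active G S).ncard) {a : ZMod ℓ → V}
    (hn : IsNormalLabelling G S a) :
    ((HasActiveGeodesicTriple G S ∨ IsOddGraph G a (maxActiveIndex G S a) ∨
      IsEvenGraph G a (maxActiveIndex G S a)) → metricDim G = branchNumber G) ∧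
    (¬ HasActiveGeodesicTriple G S → (Odd ℓ → ¬ IsOddGraph G a (maxActiveIndex G S a)) →
      (Even ℓ → ¬ IsEvenGraph G a (maxActiveIndex G S a)) →
      metricDim G = branchNumber G + 1) := by
  have H : Labelled G a := ⟨inferInstance, hG, hn.1, hℓ⟩
  have h3 := H.three_le
  obtain ⟨hSB, hSn, hSd⟩ := hS
  have hpos : ∀ s ∈ S, 0 < ht G s := fun s hs => hG.ht_pos_of_deg_one (hSd s hs)
  obtain ⟨s, hs, hs0⟩ := hG.mem_active.1 hn.2.1
  have hs0' : pos G a s = 0 := H.pos_eq (by omega) (by rw [Nat.cast_zero]; exact hs0)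
  obtain ⟨⟨t, htS, ht0⟩, hmax⟩ := H.maxActiveIndex_spec ⟨s, hs⟩
  have hrt : rt G t = a (maxActiveIndex G S a : ZMod ℓ) := by rw [← ht0, H.label_pos]
  constructor
  · intro h
    refine metricDim_eq (R := S) ?_ hSn.le fun R hR => hG.branchNumber_le_of_isMetricGenerator hR
    rcases h with h | h
    · exact H.isMetricGenerator_of_hasTriple hSB h
    · exact H.isMetricGenerator_of_graph hSB hs htS hs0 (.inl (hpos s hs)) hrt
        (.inl (hpos t htS)) h
  · intro hT hO hE
    have hcases := H.normal_cases hn hs htS hs0' ht0 hT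
    have hj1 : 1 ≤ maxActiveIndex G S a := by
      obtain ⟨x, hx, y, hy, hxy⟩ := (Set.one_lt_ncard (Set.toFinite _)).1 hA
      rw [hG.mem_active] at hx hy
      obtain ⟨u, hu, rfl⟩ := hx
      obtain ⟨v, hv, rfl⟩ := hy
      rw [Ne, ← H.pos_eq_pos] at hxy
      have := hmax u hu
      have := hmax v hv
      omega
    generalize maxActiveIndex G S a = j at *
    have hlt : ∀ R, IsMetricGenerator G R → branchNumber G + 1 ≤ R.ncard := by
      intro R hR
      have hRB := hG.isBranchResolving_of_isMetricGenerator hR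
      have hle := branchNumber_le hRB
      by_contra hcon
      have hmin : R.ncard = branchNumber G := by omega
      have hposR : ∀ r ∈ R, ∃ s ∈ S, pos G a s = pos G a r := by
        intro r hr
        obtain ⟨s, hs, h⟩ := hG.exists_rt_eq_of_min hRB hmin hSB hr
        exact ⟨s, hs, H.pos_eq_pos.2 h⟩
      rcases hcases with h2 | ⟨h2, h2'⟩
      · have hg := H.graph_of_isMetricGenerator hR hj1 h2
          (fun r hr => by
            obtain ⟨s, hs, h⟩ := hposR r hr
            rw [← h]
            exact hmax s hs)
          (fun hb => hG.exists_unhit_of_isBad hRB hmin hb)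
          (fun hb => hG.exists_unhit_of_isBad hRB hmin hb)
          (fun hb r hr => by
            by_contra hcon
            obtain ⟨s, hs, h⟩ := hposR r hr
            have := hmax s hs
            obtain ⟨w, w', hw, hw', hp, hne, hd, -⟩ := hG.exists_siblings_of_min hRB hmin hr
            -- A landmark of a minimum set strictly between the ends comes with sibling threads,
            -- hence with a branching vertex in its tree.
            refine hb (pos G a r) ⟨by omega, by omega⟩ (par G w) ?_
              (hG.isBranching_iff.2 ((Set.one_lt_ncard (Set.toFinite _)).2
                ⟨w, ⟨hw.1, rfl⟩, w', ⟨hw'.1, hp.symm⟩, hne⟩))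
            rw [H.mem_treeVerts (H.pos_lt r), H.pos_eq_pos, hG.rt_par, hG.rt_eq_of_isDesc hd])
        rcases Nat.even_or_odd ℓ with h | h
        · exact hE h (hg.2 h)
        · exact hO h (hg.1 h)
      · refine H.not_antipodal hR h2 fun r hr => ?_
        obtain ⟨s, hs, h⟩ := hposR r hr
        rw [← h]
        exact h2' s hs
    -- An index beyond `j` and at least half way round leaves no gap longer than ℓ/2, so it
    -- completes 0 and `j` to a triple.
    have hi : max (j + 1) ((ℓ + 1) / 2) < ℓ := by omega
    have hpi := H.pos_label hi
    refine metricDim_eq (R := insert (a (max (j + 1) ((ℓ + 1) / 2) : ℕ)) S) ?_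
      ((Set.ncard_insert_le _ _).trans (by omega)) hlt
    apply H.isMetricGenerator_of_triple (hG.isBranchResolving_mono hSB (Set.subset_insert _ _))
      (Set.mem_insert_of_mem _ hs) (Set.mem_insert_of_mem _ htS) (Set.mem_insert _ _) hs0' <;>
    omega

/-! ### At most one active vertex -/

/-- At `j = (ℓ - 1) / 2` with ℓ odd, all side conditions of `isMetricGenerator_of_ends` are vacuous.
-/
lemma isMetricGenerator_insert (hG : IsUnicyclic G) {R : Set V}
    (hR : IsBranchResolving G R) {s : V} (hs : s ∈ R) {a : ZMod ℓ → V} (H : Labelled G a)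
    (hs0 : rt G s = a 0) (hodd : Odd ℓ) :
    IsMetricGenerator G (insert (a (((ℓ - 1) / 2 : ℕ) : ZMod ℓ)) R) := by
  have h3 := H.three_le
  obtain ⟨n, hn⟩ := hodd
  have hs0' : pos G a s = 0 := H.pos_eq (by omega) (by rw [Nat.cast_zero]; exact hs0)
  refine H.isMetricGenerator_of_ends (hG.isBranchResolving_mono hR (Set.subset_insert _ _))
    (Set.mem_insert_of_mem _ hs) (Set.mem_insert _ _) (k := (ℓ - 2) / 2) (by omega) hs0'
    (H.pos_label (by omega)) (by omega) (by omega) (by omega) (fun x hx => ?_) (by omega)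
  have := H.pos_lt x
  omega

lemma isMetricGenerator_insert_insert (hG : IsUnicyclic G) {R : Set V}
    (hR : IsBranchResolving G R) {s : V} (hs : s ∈ R) {a : ZMod ℓ → V} (H : Labelled G a)
    (hs0 : rt G s = a 0) :
    IsMetricGenerator G
      (insert (a ((1 : ℕ) : ZMod ℓ)) (insert (a (((ℓ + 1) / 2 : ℕ) : ZMod ℓ)) R)) := by
  have h3 := H.three_le
  have hs0' : pos G a s = 0 := H.pos_eq (by omega) (by rw [Nat.cast_zero]; exact hs0)
  have h1 := H.pos_label (i := 1) (by omega)
  have h2 := H.pos_label (i := (ℓ + 1) / 2) (by omega)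
  apply H.isMetricGenerator_of_triple
    (hG.isBranchResolving_mono hR ((Set.subset_insert _ _).trans (Set.subset_insert _ _)))
    (Set.mem_insert_of_mem _ (Set.mem_insert_of_mem _ hs)) (Set.mem_insert _ _)
    (Set.mem_insert_of_mem _ (Set.mem_insert _ _)) hs0' <;> omega

lemma branchNumber_lt_of_active_singleton (hG : IsUnicyclic G) {S R : Set V}
    (hS : S ∈ minBranchSets G) {c : V} (hc : active G S = {c}) (hR : IsMetricGenerator G R) :
    branchNumber G + 1 ≤ R.ncard := by
  have hRB := hG.isBranchResolving_of_isMetricGenerator hR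
  have hle := branchNumber_le hRB
  by_contra hcon
  have hmin : R.ncard = branchNumber G := by omega
  have hact := hG.active_eq_of_min hRB hmin hS.1 hS.2.1
  rw [hc] at hact
  obtain ⟨s, hs, t, htR, hne⟩ := hG.exists_rt_ne hR
  have h1 : rt G s ∈ active G R := hG.mem_active.2 ⟨s, hs, rfl⟩
  have h2 : rt G t ∈ active G R := hG.mem_active.2 ⟨t, htR, rfl⟩
  rw [hact] at h1 h2
  exact hne (h1.trans h2.symm)

/-- A tree without vertices of `S` contains no siblings, so `t` hits no thread that needs hitting.
-/
lemma isBranchResolving_diff (hG : IsUnicyclic G) {S R : Set V} (hS : IsBranchResolving G S)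
    (hR : IsBranchResolving G R) {t : V} (ht' : rt G t ∉ active G S) :
    IsBranchResolving G (R \ {t}) := by
  have key := hG.isBranchResolving_iff.1 hR
  rw [hG.isBranchResolving_iff]
  intro w w' hw hw' hp h h'
  by_contra hne
  have hcw : w ∈ children G (par G w) := ⟨hw.1, rfl⟩
  have hcw' : w' ∈ children G (par G w) := ⟨hw'.1, hp.symm⟩
  obtain ⟨s, hs, hd⟩ := hG.exists_isDesc_of_children hS hcw hcw' hne
  have hrs := hG.rt_eq_of_isDesc hd
  have hnd : ∀ u ∈ children G (par G w), ¬ IsDesc G u t := by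
    intro u hu hut
    apply ht'
    rw [hG.mem_active]
    exact ⟨s, hs, by rw [← hrs, ← hG.rt_of_mem_children hu, hG.rt_eq_of_isDesc hut]⟩
  refine hne (key w w' hw hw' hp (fun r hr hd => ?_) (fun r hr hd => ?_))
  · by_cases hrt : r = t
    · exact hnd w hcw (hrt ▸ hd)
    · exact h r ⟨hr, hrt⟩ hd
  · by_cases hrt : r = t
    · exact hnd w' hcw' (hrt ▸ hd)
    · exact h' r ⟨hr, hrt⟩ hd

lemma exists_evenGraph_of_pair (hG : IsUnicyclic G) (hℓ : cycleLength G = ℓ) (heven : Even ℓ)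
    {R : Set V} (hR : IsMetricGenerator G R) {c c' : V} (hc : c ∈ cycleVerts G)
    (hc' : c' ∈ cycleVerts G) (hne : c ≠ c') (hRc : ∀ r ∈ R, rt G r = c ∨ rt G r = c')
    (hbad : ∀ v, v = c ∨ v = c' → IsBad G v → ∃ w ∈ children G v, ∀ r ∈ R, ¬ IsDesc G w r) :
    ∃ a : ZMod ℓ → V, IsCycleLabelling G a ∧ ∃ k : ℕ, IsEvenGraph G a k ∧
      ((a 0 = c ∧ a (k : ZMod ℓ) = c') ∨ (a 0 = c' ∧ a (k : ZMod ℓ) = c)) := by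
  obtain ⟨a, H, j, hj1, hj2, hcc⟩ := hG.exists_labelled_pair hℓ hc hc' hne
  have h3 := H.three_le
  refine ⟨a, H.labelling, j, ?_, hcc⟩
  have hpos : ∀ r ∈ R, pos G a r = 0 ∨ pos G a r = j := by
    intro r hr
    rw [← H.rt_eq_iff (show 0 < ℓ by omega), ← H.rt_eq_iff (show j < ℓ by omega), Nat.cast_zero]
    rcases hcc with ⟨h1, h2⟩ | ⟨h1, h2⟩ <;> rw [h1, h2]
    · exact hRc r hr
    · exact (hRc r hr).symm
  have hlt : 2 * j < ℓ := by
    by_contra hcon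
    exact H.not_antipodal hR (by omega) hpos
  refine (H.graph_of_isMetricGenerator hR hj1 hlt (fun r hr => ?_) (hbad _ ?_) (hbad _ ?_)
    (fun _ => hpos)).2 heven
  · have := hpos r hr; omega
  · rcases hcc with ⟨h1, h2⟩ | ⟨h1, h2⟩
    exacts [.inl h1, .inr h1]
  · rcases hcc with ⟨h1, h2⟩ | ⟨h1, h2⟩
    exacts [.inr h2, .inl h2]

lemma eq_empty_of_active_eq_empty (hG : IsUnicyclic G) {S : Set V} (h : active G S = ∅) :
    S = ∅ := by
  rw [Set.eq_empty_iff_forall_notMem]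
  intro s hs
  have : rt G s ∈ active G S := hG.mem_active.2 ⟨s, hs, rfl⟩
  rw [h] at this
  exact this

lemma two_le_ncard (hG : IsUnicyclic G) {R : Set V} (hR : IsMetricGenerator G R) :
    2 ≤ R.ncard := by
  obtain ⟨s, hs, t, htR, hne⟩ := hG.exists_rt_ne hR
  exact (Set.one_lt_ncard (Set.toFinite _)).2 ⟨s, hs, t, htR, fun h => hne (h ▸ rfl)⟩

lemma metricDim_of_odd_of_active_empty (hG : IsUnicyclic G) (hℓ : cycleLength G = ℓ) {S : Set V}
    (hS : S ∈ minBranchSets G) (hodd : Odd ℓ) (hA : active G S = ∅) : metricDim G = 2 := by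
  obtain ⟨c, hc⟩ := hG.cycleVerts_nonempty
  obtain ⟨a, H, rfl⟩ := hG.exists_labelled hℓ hc
  refine metricDim_eq (hG.isMetricGenerator_insert (R := {a 0})
    (hG.isBranchResolving_mono hS.1 ?_) rfl H (H.rt_label 0) hodd) ?_ fun R hR => hG.two_le_ncard hR
  · rw [hG.eq_empty_of_active_eq_empty hA]; exact Set.empty_subset _
  · refine (Set.ncard_insert_le _ _).trans ?_
    rw [Set.ncard_singleton]

lemma metricDim_of_odd_of_active_singleton (hG : IsUnicyclic G) (hℓ : cycleLength G = ℓ)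
    {S : Set V} (hS : S ∈ minBranchSets G) (hodd : Odd ℓ) {c : V} (hA : active G S = {c}) :
    metricDim G = branchNumber G + 1 := by
  have hc : c ∈ active G S := hA ▸ rfl
  obtain ⟨a, H, rfl⟩ := hG.exists_labelled hℓ hc.1
  obtain ⟨s, hs, hs0⟩ := hG.mem_active.1 hc
  refine metricDim_eq (hG.isMetricGenerator_insert hS.1 hs H hs0 hodd) ?_
    fun R hR => hG.branchNumber_lt_of_active_singleton hS hA hR
  refine (Set.ncard_insert_le _ _).trans ?_
  rw [hS.2.1]

lemma metricDim_of_even_of_active_empty (hG : IsUnicyclic G) (hℓ : cycleLength G = ℓ) {S : Set V}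
    (hS : S ∈ minBranchSets G) (heven : Even ℓ) (hA : active G S = ∅) :
    ((∃ a : ZMod ℓ → V, IsCycleLabelling G a ∧ ∃ k : ℕ, IsEvenGraph G a k) → metricDim G = 2) ∧
    (¬ (∃ a : ZMod ℓ → V, IsCycleLabelling G a ∧ ∃ k : ℕ, IsEvenGraph G a k) →
      metricDim G = 3) := by
  have hS0 := hG.eq_empty_of_active_eq_empty hA
  have hBR : ∀ R, IsBranchResolving G R :=
    fun R => hG.isBranchResolving_mono hS.1 (by rw [hS0]; exact Set.empty_subset _)
  constructor
  · rintro ⟨a, ha, k, hk⟩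
    have H : Labelled G a := ⟨inferInstance, hG, ha, hℓ⟩
    obtain ⟨s, hs0, hs1⟩ := exists_rt_eq_and hG (H.mem_cycleVerts 0)
    obtain ⟨t, ht0, ht1⟩ := exists_rt_eq_and hG (H.mem_cycleVerts k)
    refine metricDim_eq (R := {s, t}) (H.isMetricGenerator_of_graph (hBR _) (by simp) (by simp)
      hs0 hs1 ht0 ht1 (.inr hk)) ?_ fun R hR => hG.two_le_ncard hR
    refine (Set.ncard_insert_le _ _).trans ?_
    rw [Set.ncard_singleton]
  · intro hno
    obtain ⟨c, hc⟩ := hG.cycleVerts_nonempty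
    obtain ⟨a, H, rfl⟩ := hG.exists_labelled hℓ hc
    refine metricDim_eq (hG.isMetricGenerator_insert_insert (R := {a 0}) (hBR _) rfl H
      (H.rt_label 0)) ?_ fun R hR => ?_
    · have h1 := Set.ncard_insert_le (a ((1 : ℕ) : ZMod ℓ))
        (insert (a (((ℓ + 1) / 2 : ℕ) : ZMod ℓ)) {a 0})
      have h2 := Set.ncard_insert_le (a (((ℓ + 1) / 2 : ℕ) : ZMod ℓ)) {a 0}
      rw [Set.ncard_singleton] at h2
      omega
    · by_contra hcon
      obtain ⟨s, hs, t, htR, hne⟩ := hG.exists_rt_ne hR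
      have hsub : {s, t} ⊆ R := by
        rintro x (rfl | rfl) <;> assumption
      have hst : s ≠ t := fun h => hne (h ▸ rfl)
      have heq := Set.eq_of_subset_of_ncard_le hsub (by rw [Set.ncard_pair hst]; omega)
        (Set.toFinite _)
      obtain ⟨b, hb, k, hk, -⟩ := hG.exists_evenGraph_of_pair hℓ heven hR (hG.rt_mem s)
        (hG.rt_mem t) hne (fun r hr => by
          rw [← heq] at hr
          rcases hr with rfl | rfl
          exacts [.inl rfl, .inr rfl])
        (fun v _ hbad => by
          -- With `S` empty there are no branching vertices, hence no bad ones.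
          obtain ⟨u, hu, -⟩ := hG.exists_rt_eq_of_isBranching hS.1 (hbad.isBranching)
          rw [hS0] at hu
          exact hu.elim)
      exact hno ⟨b, hb, k, hk⟩

lemma metricDim_of_even_of_active_singleton (hG : IsUnicyclic G) (hℓ : cycleLength G = ℓ)
    {S : Set V} (hS : S ∈ minBranchSets G) (heven : Even ℓ) {c : V} (hA : active G S = {c}) :
    ((∃ c' ∈ cycleVerts G \ {c}, ∃ a : ZMod ℓ → V, IsCycleLabelling G a ∧
        ∃ k : ℕ, IsEvenGraph G a k ∧
          ((a 0 = c ∧ a (k : ZMod ℓ) = c') ∨ (a 0 = c' ∧ a (k : ZMod ℓ) = c))) →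
      metricDim G = branchNumber G + 1) ∧
    (¬ (∃ c' ∈ cycleVerts G \ {c}, ∃ a : ZMod ℓ → V, IsCycleLabelling G a ∧
        ∃ k : ℕ, IsEvenGraph G a k ∧
          ((a 0 = c ∧ a (k : ZMod ℓ) = c') ∨ (a 0 = c' ∧ a (k : ZMod ℓ) = c))) →
      metricDim G = branchNumber G + 2) := by
  have hc : c ∈ active G S := hA ▸ rfl
  obtain ⟨s, hs, hs0⟩ := hG.mem_active.1 hc
  have hs1 : 0 < ht G s := hG.ht_pos_of_deg_one (hS.2.2 s hs)
  constructor
  · rintro ⟨c', ⟨hc', -⟩, a, ha, k, hk, hcc⟩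
    have H : Labelled G a := ⟨inferInstance, hG, ha, hℓ⟩
    obtain ⟨t, ht0, ht1⟩ := exists_rt_eq_and hG hc'
    have hBR := hG.isBranchResolving_mono hS.1 (Set.subset_insert t S)
    refine metricDim_eq (R := insert t S) ?_ ((Set.ncard_insert_le _ _).trans (by rw [hS.2.1]))
      fun R hR => hG.branchNumber_lt_of_active_singleton hS hA hR
    rcases hcc with ⟨h0, hj⟩ | ⟨h0, hj⟩
    · exact H.isMetricGenerator_of_graph hBR (Set.mem_insert_of_mem _ hs) (Set.mem_insert _ _)
        (hs0.trans h0.symm) (.inl hs1) (ht0.trans hj.symm) (hj.symm ▸ ht1) (.inr hk)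
    · exact H.isMetricGenerator_of_graph hBR (Set.mem_insert _ _) (Set.mem_insert_of_mem _ hs)
        (ht0.trans h0.symm) (h0.symm ▸ ht1) (hs0.trans hj.symm) (.inl hs1) (.inr hk)
  · intro hno
    obtain ⟨a, H, ha0⟩ := hG.exists_labelled hℓ hc.1
    refine metricDim_eq (hG.isMetricGenerator_insert_insert hS.1 hs H (hs0.trans ha0.symm)) ?_
      fun R hR => ?_
    · have h1 := Set.ncard_insert_le (a ((1 : ℕ) : ZMod ℓ))
        (insert (a (((ℓ + 1) / 2 : ℕ) : ZMod ℓ)) S)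
      have h2 := Set.ncard_insert_le (a (((ℓ + 1) / 2 : ℕ) : ZMod ℓ)) S
      have h3 := hS.2.1
      omega
    · have h1 := hG.branchNumber_lt_of_active_singleton hS hA hR
      by_contra hcon
      obtain ⟨t, htR, htc⟩ : ∃ t ∈ R, rt G t ≠ c := by
        obtain ⟨u, hu, v, hv, hne⟩ := hG.exists_rt_ne hR
        by_cases huc : rt G u = c
        · exact ⟨v, hv, fun hvc => hne (huc.trans hvc.symm)⟩
        · exact ⟨u, hu, huc⟩
      have hRB := hG.isBranchResolving_of_isMetricGenerator hR
      -- A generator of size L(G) + 1 splits into a minimum branch-resolving set, whose only active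
      -- vertex is `c`, and the single landmark `t`.
      have hBR := hG.isBranchResolving_diff hS.1 hRB (t := t) (by rw [hA]; exact htc)
      have hmin : (R \ {t}).ncard = branchNumber G := by
        have := Set.ncard_sdiff_singleton_add_one htR (Set.toFinite R)
        omega
      have hact := hG.active_eq_of_min hBR hmin hS.1 hS.2.1
      rw [hA] at hact
      refine hno ⟨rt G t, ⟨hG.rt_mem t, htc⟩, hG.exists_evenGraph_of_pair hℓ heven hR hc.1
        (hG.rt_mem t) (Ne.symm htc) (fun r hr => ?_) ?_⟩
      · by_cases hrt : r = t
        · exact .inr (hrt ▸ rfl)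
        · have : rt G r ∈ active G (R \ {t}) := hG.mem_active.2 ⟨r, ⟨hr, hrt⟩, rfl⟩
          rw [hact] at this
          exact .inl this
      · rintro v (rfl | rfl) hbad
        · obtain ⟨w, hw, hun⟩ := hG.exists_unhit_of_isBad hBR hmin hbad
          refine ⟨w, hw, fun r hr hd => ?_⟩
          by_cases hrt : r = t
          · subst hrt
            apply htc
            rw [← hG.rt_eq_of_isDesc hd, hG.rt_of_mem_children hw,
              rt_of_ht_eq_zero (hG.ht_eq_zero.2 hc.1)]
          · exact hun r ⟨hr, hrt⟩ hd
        · obtain ⟨u, hu, hru⟩ :=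
            hG.exists_rt_eq_of_isBranching hS.1 (hbad.isBranching)
          rw [rt_of_ht_eq_zero (hG.ht_rt t)] at hru
          have : rt G t ∈ active G S := hG.mem_active.2 ⟨u, hu, hru⟩
          rw [hA] at this
          exact absurd this htc

end IsUnicyclic

end

end UnicyclicDim

/-! ### The dimension formula -/

theorem corollary1 {V : Type*} [Finite V] (G : SimpleGraph V) (hG : IsUnicyclic G)
    (ℓ : ℕ) (hℓ : cycleLength G = ℓ) (S : Set V) (hS : S ∈ minBranchSets G) :
    (Odd ℓ →
      (active G S = ∅ → metricDim G = 2) ∧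
      ((active G S).ncard = 1 → metricDim G = branchNumber G + 1) ∧
      (2 ≤ (active G S).ncard →
        ∀ a : ZMod ℓ → V, IsNormalLabelling G S a → ∀ j : ℕ, j = maxActiveIndex G S a →
          ((HasActiveGeodesicTriple G S ∨ IsOddGraph G a j) →
            metricDim G = branchNumber G) ∧
          (¬ (HasActiveGeodesicTriple G S ∨ IsOddGraph G a j) →
            metricDim G = branchNumber G + 1))) ∧
    (Even ℓ →
      (active G S = ∅ →
        ((∃ a : ZMod ℓ → V, IsCycleLabelling G a ∧ ∃ k : ℕ, IsEvenGraph G a k) →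
          metricDim G = 2) ∧
        (¬ (∃ a : ZMod ℓ → V, IsCycleLabelling G a ∧ ∃ k : ℕ, IsEvenGraph G a k) →
          metricDim G = 3)) ∧
      (∀ c : V, active G S = {c} →
        ((∃ c' ∈ cycleVerts G \ {c}, ∃ a : ZMod ℓ → V, IsCycleLabelling G a ∧
            ∃ k : ℕ, IsEvenGraph G a k ∧
              ((a 0 = c ∧ a (k : ZMod ℓ) = c') ∨ (a 0 = c' ∧ a (k : ZMod ℓ) = c))) →
          metricDim G = branchNumber G + 1) ∧
        (¬ (∃ c' ∈ cycleVerts G \ {c}, ∃ a : ZMod ℓ → V, IsCycleLabelling G a ∧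
            ∃ k : ℕ, IsEvenGraph G a k ∧
              ((a 0 = c ∧ a (k : ZMod ℓ) = c') ∨ (a 0 = c' ∧ a (k : ZMod ℓ) = c))) →
          metricDim G = branchNumber G + 2)) ∧
      (2 ≤ (active G S).ncard →
        ∀ a : ZMod ℓ → V, IsNormalLabelling G S a → ∀ j : ℕ, j = maxActiveIndex G S a →
          ((HasActiveGeodesicTriple G S ∨ IsEvenGraph G a j) →
            metricDim G = branchNumber G) ∧
          (¬ (HasActiveGeodesicTriple G S ∨ IsEvenGraph G a j) →
            metricDim G = branchNumber G + 1))) := by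
  refine ⟨fun hodd => ⟨hG.metricDim_of_odd_of_active_empty hℓ hS hodd, fun h1 => ?_,
    fun h2 a ha j hj => ?_⟩, fun heven => ⟨hG.metricDim_of_even_of_active_empty hℓ hS heven,
    fun c hc => hG.metricDim_of_even_of_active_singleton hℓ hS heven hc, fun h2 a ha j hj => ?_⟩⟩
  · obtain ⟨c, hc⟩ := Set.ncard_eq_one.1 h1
    exact hG.metricDim_of_odd_of_active_singleton hℓ hS hodd hc
  · subst hj
    obtain ⟨h3, h4⟩ := hG.metricDim_of_two_active hℓ hS h2 ha
    exact ⟨fun h => h3 (h.imp_right .inl), fun h => h4 (fun hT => h (.inl hT))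
      (fun _ hO => h (.inr hO)) (fun heven => absurd hodd (Nat.not_odd_iff_even.2 heven))⟩
  · subst hj
    obtain ⟨h3, h4⟩ := hG.metricDim_of_two_active hℓ hS h2 ha
    exact ⟨fun h => h3 (h.imp_right .inr), fun h => h4 (fun hT => h (.inl hT))
      (fun hodd => absurd hodd (Nat.not_odd_iff_even.2 heven)) (fun _ hE => h (.inr hE))⟩
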